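/- All graphs are finite and simple. A star edge coloring of a graph $G$ is a proper edge coloring for which no path of length four and no cycle of length four in $G$ is bichromatic. The star chromatic index $\chi'_{\mathrm{star}}(G)$ is the least $k$ such that $G$ has a star edge coloring with colors from $\{1,\dots,k\}$. The list star chromatic index $\mathrm{ch}'_{\mathrm{star}}(G)$ is the least $k$ such that, for every assignment of finite lists $L(e)$ with $|L(e)|\ge k$ to the edges $e$ of $G$, there is a star edge coloring $\varphi$ of $G$ with $\varphi(e)\in L(e)$ for all edges $e$. A generalized Halin graph is a plane graph $H=T\cup C$ that consists of a plane embedding of a tree $T$ (the characteristic tree) with maximum degree at least $3$ and a cycle $C$ through exactly the leaves of $T$, such that $C$ is the boundary of the exterior face; it is a Halin graph if moreover $T$ has no vertex of degree $2$. (Plane embeddings are described combinatorially, by rotation systems satisfying Euler's formula $|V|-|E|+|F|=2$ with one face designated as the exterior face.) Theorem. (1) If $H$ is a generalized Halin graph with maximum degree $\Delta\ge 13$, then $$\mathrm{ch}'_{\mathrm{star}}(H)\le\left\lfloor\tfrac{3\Delta}{2}\right\rfloor .$$ (2) If $H$ is a generalized Halin graph with maximum degree $\Delta\ge 13$ whose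 characteristic tree $T$ satisfies $\chi'_{\mathrm{star}}(T)=\lfloor 3\Delta/2\rfloor$, then $$\mathrm{ch}'_{\mathrm{star}}(H)=\chi'_{\mathrm{star}}(H)=\left\lfloor\tfrac{3\Delta}{2}\right\rfloor .$$ (3) The bound is tight for every maximum degree: for each integer $\Delta\ge 13$ there is a Halin graph $H$ with maximum degree $\Delta$ and with characteristic tree $T$ such that $\chi'_{\mathrm{star}}(T)=\chi'_{\mathrm{star}}(H)=\mathrm{ch}'_{\mathrm{star}}(H)=\lfloor 3\Delta/2\rfloor$. -/

import Mathlib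

namespace SimpleGraph

section StarEdgeColoring

variable {V : Type*}

/-- A star edge coloring: a proper edge coloring such that no path of length four and no cycle of
length four is bichromatic. The set whose cardinality is taken is the set of colors that occur on
the edges of the path or cycle. -/
structure IsStarEdgeColoring (G : SimpleGraph V) {K : Type*} (c : G.EdgeLabeling K) : Prop where
  /-- Distinct edges with a common end get distinct colors. -/
  proper : ∀ e f : G.edgeSet, e ≠ f → (∃ v, v ∈ (e : Sym2 V) ∧ v ∈ (f : Sym2 V)) → c e ≠ c f
  /-- No path of length four is bichromatic. -/
  path : ∀ (u v : V) (p : G.Walk u v), p.IsPath → p.length = 4 →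
    (c '' {e : G.edgeSet | (e : Sym2 V) ∈ p.edges}).ncard ≠ 2
  /-- No cycle of length four is bichromatic. -/
  cycle : ∀ (u : V) (p : G.Walk u u), p.IsCycle → p.length = 4 →
    (c '' {e : G.edgeSet | (e : Sym2 V) ∈ p.edges}).ncard ≠ 2

/-- `G` admits a star `k`-edge coloring. -/
def StarEdgeColorable (G : SimpleGraph V) (k : ℕ) : Prop :=
  ∃ c : G.EdgeLabeling (Fin k), G.IsStarEdgeColoring c

/-- `G` is star `k`-edge choosable: for every assignment `L` of finite lists with at least `k`
colors to the edges there is a star edge coloring that takes the color of each edge from the list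
of that edge. -/
def StarEdgeChoosable (G : SimpleGraph V) (k : ℕ) : Prop :=
  ∀ L : G.edgeSet → Finset ℕ, (∀ e, k ≤ (L e).card) →
    ∃ c : G.EdgeLabeling ℕ, G.IsStarEdgeColoring c ∧ ∀ e, c e ∈ L e

/-- The star chromatic index: the least `k` such that `G` has a star `k`-edge coloring
(`⊤` if there is none, which does not happen for a finite graph). -/
noncomputable def starChromaticIndex (G : SimpleGraph V) : ℕ∞ :=
  ⨅ k ∈ {k : ℕ | G.StarEdgeColorable k}, (k : ℕ∞)

/-- The list star chromatic index: the least `k` such that `G` is star `k`-edge choosable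
(`⊤` if there is none, which does not happen for a finite graph). -/
noncomputable def listStarChromaticIndex (G : SimpleGraph V) : ℕ∞ :=
  ⨅ k ∈ {k : ℕ | G.StarEdgeChoosable k}, (k : ℕ∞)

end StarEdgeColoring

section Embedding

variable {V : Type*}

/-- A rotation system of `G`, that is, a cellular embedding of (each component of) `G` in an
oriented closed surface, given by the cyclic order of the darts around each vertex: `next d` is the
dart that follows `d` counterclockwise among the darts that start at the same vertex. -/
structure RotationSystem (G : SimpleGraph V) where
  /-- The counterclockwise successor around the initial vertex. -/
  next : Equiv.Perm G.Dart
  /-- The cycles of `next` are exactly the sets of all darts that start at a given vertex. -/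
  sameCycle_iff : ∀ d e : G.Dart, next.SameCycle d e ↔ d.fst = e.fst

namespace RotationSystem

variable {G : SimpleGraph V} (σ : G.RotationSystem)

/-- The face permutation: from a dart `d` one goes along its edge to the other end, and continues
with the dart that follows the reversal of `d` in the rotation there. The cycles of this permutation
are the boundary walks of the faces. -/
def facePerm : Equiv.Perm G.Dart :=
  (Function.Involutive.toPerm Dart.symm Dart.symm_involutive).trans σ.next

/-- The faces of the embedding: the cycles of the face permutation. -/
abbrev Face : Type _ := Quotient (Equiv.Perm.SameCycle.setoid σ.facePerm)

/-- The face whose boundary walk contains the dart `d`. -/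
def faceOf (d : G.Dart) : σ.Face := Quotient.mk _ d

/-- The set of the edges on the boundary of a face. -/
def boundary (F : σ.Face) : Set (Sym2 V) := {e | ∃ d : G.Dart, σ.faceOf d = F ∧ d.edge = e}

/-- The embedding is an embedding in the sphere (equivalently, in the plane, where any one of the
faces may be taken as the exterior face): `G` is connected and the surface has Euler characteristic
two, `|V| + |F| = |E| + 2`. (For finite connected graphs with at least one edge.) -/
def IsPlane : Prop :=
  G.Connected ∧ Nat.card V + Nat.card σ.Face = Nat.card G.edgeSet + 2

end RotationSystem

end Embedding

section Halin

variable {V : Type*} [Fintype V]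

open scoped Classical in
/-- `C` is a cycle through exactly the leaves of `T`: there is a cyclic walk in `C` that visits
exactly the vertices of degree one of `T` and runs through all edges of `C`. -/
def IsLeafCycle (T C : SimpleGraph V) : Prop :=
  ∃ (x : V) (p : C.Walk x x), p.IsCycle ∧ (∀ v, v ∈ p.support ↔ T.degree v = 1) ∧
    ∀ e ∈ C.edgeSet, e ∈ p.edges

open scoped Classical in
/-- `H` is a generalized Halin graph with characteristic tree `T` and adjoint cycle `C`:
`H = T ∪ C`, where `T` is a tree (on all vertices of `H`) with maximum degree at least three and `C`
is a cycle connecting all the leaves of `T`, and `H` has a plane embedding in which `C` is the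
boundary of a face `F` (the exterior face). -/
structure IsGeneralizedHalin (H T C : SimpleGraph V) : Prop where
  isTree : T.IsTree
  three_le_maxDegree : 3 ≤ T.maxDegree
  leafCycle : IsLeafCycle T C
  eq_sup : H = T ⊔ C
  embedding : ∃ σ : H.RotationSystem, σ.IsPlane ∧ ∃ F : σ.Face, σ.boundary F = C.edgeSet

open scoped Classical in
/-- `H` is a Halin graph with characteristic tree `T` and adjoint cycle `C`: moreover, `T` has no
vertex of degree two. -/
structure IsHalin (H T C : SimpleGraph V) : Prop extends IsGeneralizedHalin H T C where
  degree_ne_two : ∀ v, T.degree v ≠ 2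

end Halin

end SimpleGraph

/-! Put m = ⌊Δ/2⌋, so that lists have at least Δ + m colors. A coloring is a star edge coloring if
it is proper and, for any two neighbors a, b of a vertex u, the color of ub is missing at a or the
color of ua is missing at b. At each inner vertex u of the tree the choice between the two is fixed
in advance: the neighbors of u are placed in the circular tournament on 2m + 1 positions, and if a
beats b, then the color of ub has to be missing at a. Every position beats m others and is beaten by
m others.

The tree is colored outward from a root (`IsTournamentColoring.exists_insert`). When a vertex u with
colored neighbor p is added, the new edges at u avoid the color of pu and the at most m colors of
edges pb such that u beats b at p. This leaves Δ - 1 colors for at most Δ - 1 edges. The colors that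
nevertheless recur at p belong to edges pa such that a beats u, so there are at most m of them, and
p can be placed at u so that it is beaten by all the edges concerned (`exists_position`).

The cycle needs one more property of the tree coloring: pendant edges at consecutive leaves differ
in color. This is where planarity enters. The branch that hangs at u is joined to the rest by at
most two edges of C (`IsGeneralizedHalin.ncard_cycle_cut_le`), since every interior face has exactly
one edge of C. So the lists at u lose at most two colors in total, and Hall's condition still holds
(`exists_injOn_of_sum_le_two`). An edge of C then has to avoid m + 1 colors at each end and two
further pendant colors, which leaves Δ - m - 4 ≥ 3 colors exactly when Δ ≥ 13. Three colors per edge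
suffice for a cycle of length at least 8 (`exists_cyclic_list_coloring`).

For the lower bound, let a vertex u of degree d in a tree have only neighbors of degree at least d.
Of two neighbors a, b of u, at most one sees the color of the other one's edge to u, so on average a
neighbor sees at most (d - 1)/2 of the colors of the other edges at u. A neighbor with at most that
many forces ⌊3d/2⌋ colors (`IsTree.le_of_starEdgeColorable`). The tree of radius two with all inner
degrees d has such a center, and an explicit rotation system with labeled faces makes it the
characteristic tree of a Halin graph. -/

namespace SimpleGraph

/-! ### Star edge colorings: a local criterion and monotonicity. -/

section StarCriterion

variable {V : Type*} {G : SimpleGraph V} {K : Type*}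

theorem eq_and_eq_of_ncard_eq_two {S : Set K} (hS : S.ncard = 2) {p q r s : K} (hp : p ∈ S)
    (hq : q ∈ S) (hr : r ∈ S) (hs : s ∈ S) (hpq : p ≠ q) (hqr : q ≠ r) (hrs : r ≠ s) :
    p = r ∧ q = s := by
  obtain ⟨x, y, -, rfl⟩ := Set.ncard_eq_two.1 hS
  simp only [Set.mem_insert_iff, Set.mem_singleton_iff] at hp hq hr hs
  grind

/-- A coloring is a star edge coloring if it is proper and, for two neighbors `a` and `b` of a
vertex `u`, the color of `ub` does not occur at `a` or the color of `ua` does not occur at `b`. -/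
theorem isStarEdgeColoring_of_proper (c : Sym2 V → K)
    (proper : ∀ u a b, G.Adj u a → G.Adj u b → a ≠ b → c s(u, a) ≠ c s(u, b))
    (anti : ∀ u a b a' b', G.Adj u a → G.Adj u b → a ≠ b → G.Adj a a' → G.Adj b b' →
      c s(a, a') = c s(u, b) → c s(b, b') ≠ c s(u, a)) :
    G.IsStarEdgeColoring (fun e : G.edgeSet => c e) := by
  -- The ends v₀ and v₄ may coincide, so that paths and cycles of length four are treated alike.
  -- With two colors, properness forces the colors to alternate, which the hypothesis `anti`
  -- excludes at the middle vertex v₂.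
  have key : ∀ v₀ v₁ v₂ v₃ v₄ : V, G.Adj v₀ v₁ → G.Adj v₁ v₂ → G.Adj v₂ v₃ → G.Adj v₃ v₄ →
      v₀ ≠ v₂ → v₁ ≠ v₃ → v₂ ≠ v₄ → ∀ S : Set K, c s(v₀, v₁) ∈ S → c s(v₁, v₂) ∈ S →
      c s(v₂, v₃) ∈ S → c s(v₃, v₄) ∈ S → S.ncard ≠ 2 := by
    intro v₀ v₁ v₂ v₃ v₄ h01 h12 h23 h34 n02 n13 n24 S m1 m2 m3 m4 hS
    obtain ⟨e1, e2⟩ := eq_and_eq_of_ncard_eq_two hS m1 m2 m3 m4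
      (by rw [Sym2.eq_swap]; exact proper v₁ v₀ v₂ h01.symm h12 n02)
      (by rw [Sym2.eq_swap]; exact proper v₂ v₁ v₃ h12.symm h23 n13)
      (by rw [Sym2.eq_swap]; exact proper v₃ v₂ v₄ h23.symm h34 n24)
    refine anti v₂ v₁ v₃ v₀ v₄ h12.symm h23 n13 h01.symm h34 ?_ ?_
    · rw [Sym2.eq_swap, e1]
    · rw [← e2, Sym2.eq_swap]
  have image : ∀ {u v : V} (p : G.Walk u v) {x y : V}, s(x, y) ∈ p.edges →
      c s(x, y) ∈ (fun e : G.edgeSet => c e) '' {e : G.edgeSet | (e : Sym2 V) ∈ p.edges} :=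
    fun p x y h => ⟨⟨s(x, y), p.edges_subset_edgeSet h⟩, h, rfl⟩
  constructor
  · rintro ⟨e, he⟩ ⟨f, hf⟩ hef ⟨v, hve, hvf⟩
    obtain ⟨a, rfl⟩ := Sym2.mem_iff_exists.1 hve
    obtain ⟨b, rfl⟩ := Sym2.mem_iff_exists.1 hvf
    refine proper v a b he hf ?_
    rintro rfl
    exact hef rfl
  · intro u v p hp hl
    match p, hp, hl with
    | .cons h1 (.cons h2 (.cons h3 (.cons h4 .nil))), hp, _ =>
      rw [Walk.isPath_def] at hp
      refine key _ _ _ _ _ h1 h2 h3 h4 ?_ ?_ ?_ _ (image _ ?_) (image _ ?_) (image _ ?_)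
        (image _ ?_)
      all_goals simp_all
  · intro u p hp hl
    match p, hp, hl with
    | .cons h1 (.cons h2 (.cons h3 (.cons h4 .nil))), hp, _ =>
      have hp := hp.support_nodup
      refine key _ _ _ _ _ h1 h2 h3 h4 ?_ ?_ ?_ _ (image _ ?_) (image _ ?_) (image _ ?_)
        (image _ ?_)
      pick_goal 4; simp
      pick_goal 4; simp
      pick_goal 4; simp
      pick_goal 4; simp
      all_goals
        simp only [Walk.support_cons, Walk.support_nil, List.tail_cons, List.nodup_cons,
          List.mem_cons, List.not_mem_nil, or_false, not_or] at hp
      · exact fun h => hp.2.1.2 h.symm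
      · exact hp.1.2.1
      · exact hp.2.1.2

theorem IsStarEdgeColoring.not_bichromatic {c : G.EdgeLabeling K} (hc : G.IsStarEdgeColoring c)
    {v₀ v₁ v₂ v₃ v₄ : V} (h1 : G.Adj v₀ v₁) (h2 : G.Adj v₁ v₂) (h3 : G.Adj v₂ v₃)
    (h4 : G.Adj v₃ v₄) (hn : [v₀, v₁, v₂, v₃, v₄].Nodup)
    (e1 : c ⟨s(v₀, v₁), h1⟩ = c ⟨s(v₂, v₃), h3⟩) : c ⟨s(v₁, v₂), h2⟩ ≠ c ⟨s(v₃, v₄), h4⟩ := by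
  intro e2
  refine hc.path _ _ (.cons h1 (.cons h2 (.cons h3 (.cons h4 .nil))))
    ((Walk.isPath_def _).2 (by simpa using hn)) rfl ?_
  have : c '' {e : G.edgeSet | (e : Sym2 V) ∈
      (Walk.cons h1 (.cons h2 (.cons h3 (.cons h4 .nil)))).edges} =
      {c ⟨s(v₀, v₁), h1⟩, c ⟨s(v₁, v₂), h2⟩} := by
    ext k
    constructor
    · rintro ⟨⟨e, he⟩, hm, rfl⟩
      simp only [Walk.edges_cons, Walk.edges_nil, List.mem_cons, Set.mem_ofPred_eq,
        List.not_mem_nil, or_false] at hm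
      rcases hm with rfl | rfl | rfl | rfl
      · left; rfl
      · right; rfl
      · left; exact e1.symm
      · right; exact e2.symm
    · rintro (rfl | rfl)
      · exact ⟨_, by simp, rfl⟩
      · exact ⟨_, by simp, rfl⟩
  rw [this]
  refine Set.ncard_pair (hc.proper _ _ ?_ ⟨v₁, by simp, by simp⟩)
  intro h
  have h := Sym2.eq_iff.1 (congrArg Subtype.val h)
  simp at hn
  grind

/-- Only equalities between colors matter. This allows passing from colors in ℕ to colors in `Fin
k`. -/
theorem IsStarEdgeColoring.of_comp {K' : Type*} {c : G.EdgeLabeling K} {f : K → K'}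
    (hf : f.Injective) (hc : G.IsStarEdgeColoring (fun e => f (c e) : G.EdgeLabeling K')) :
    G.IsStarEdgeColoring c := by
  have image : ∀ S : Set G.edgeSet, ((fun e => f (c e)) '' S).ncard = (c '' S).ncard := by
    intro S
    exact (congrArg Set.ncard (Set.image_image f c S)).symm.trans
      (Set.ncard_image_of_injective (c '' S) hf)
  constructor
  · intro e g heg hv h
    exact hc.proper e g heg hv (congrArg f h)
  · intro u v p hp hl
    rw [← image]
    exact hc.path u v p hp hl
  · intro u p hp hl
    rw [← image]
    exact hc.cycle u p hp hl

theorem IsStarEdgeColoring.mono {G' : SimpleGraph V} (h : G' ≤ G) {c : G.EdgeLabeling K}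
    (hc : G.IsStarEdgeColoring c) :
    G'.IsStarEdgeColoring (fun e => c ⟨e, edgeSet_mono h e.2⟩ : G'.EdgeLabeling K) := by
  have image : ∀ {u v : V} (p : G'.Walk u v),
      (fun e : G'.edgeSet => c ⟨e, edgeSet_mono h e.2⟩) ''
        {e : G'.edgeSet | (e : Sym2 V) ∈ p.edges} =
      c '' {e : G.edgeSet | (e : Sym2 V) ∈ (p.mapLe h).edges} := by
    intro u v p
    ext k
    constructor
    · rintro ⟨e, he, rfl⟩
      exact ⟨⟨e, _⟩, by simpa using he, rfl⟩
    · rintro ⟨⟨e, he'⟩, he, rfl⟩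
      have he : e ∈ p.edges := by simpa using he
      exact ⟨⟨e, p.edges_subset_edgeSet he⟩, he, rfl⟩
  constructor
  · intro e g heg hv
    exact hc.proper _ _ (fun h => heg (Subtype.ext (Subtype.mk.inj h))) hv
  · intro u v p hp hl
    rw [image]
    exact hc.path u v _ (hp.mapLe h) (by simpa using hl)
  · intro u p hp hl
    rw [image]
    exact hc.cycle u _ (hp.mapLe h) (by simpa using hl)

theorem StarEdgeColorable.mono {G' : SimpleGraph V} (h : G' ≤ G) {k : ℕ}
    (hG : G.StarEdgeColorable k) : G'.StarEdgeColorable k :=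
  hG.elim fun _ hc => ⟨_, hc.mono h⟩

theorem StarEdgeChoosable.colorable {k : ℕ} (hG : G.StarEdgeChoosable k) :
    G.StarEdgeColorable k := by
  obtain ⟨c, hc, hk⟩ := hG (fun _ => Finset.range k) (fun _ => by simp)
  refine ⟨fun e => ⟨c e, Finset.mem_range.1 (hk e)⟩, ?_⟩
  exact IsStarEdgeColoring.of_comp (f := Fin.val) Fin.val_injective hc

theorem starChromaticIndex_mono {G' : SimpleGraph V} (h : G' ≤ G) :
    G'.starChromaticIndex ≤ G.starChromaticIndex :=
  le_iInf₂ fun k hk => iInf₂_le (f := fun (k : ℕ) _ => (k : ℕ∞)) k (StarEdgeColorable.mono h hk)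

theorem starChromaticIndex_le_listStarChromaticIndex :
    G.starChromaticIndex ≤ G.listStarChromaticIndex :=
  le_iInf₂ fun k hk => iInf₂_le (f := fun (k : ℕ) _ => (k : ℕ∞)) k
    (StarEdgeChoosable.colorable hk)

theorem StarEdgeChoosable.listStarChromaticIndex_le {k : ℕ} (h : G.StarEdgeChoosable k) :
    G.listStarChromaticIndex ≤ k :=
  iInf₂_le (f := fun (k : ℕ) _ => (k : ℕ∞)) k h

end StarCriterion

/-! ### The circular tournament. -/

section Tournament

/-- The circular tournament on `{0, …, 2m}`: the vertex `i` beats the `m` vertices that follow it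
cyclically. -/
def Beats (m i j : ℕ) : Prop := (i < j ∧ j ≤ i + m) ∨ j + m < i

theorem beats_or_beats (m : ℕ) {i j : ℕ} (h : i ≠ j) :
    Beats m i j ∨ Beats m j i := by
  unfold Beats; omega

theorem Beats.not_beats {m i j : ℕ} (hi : i ≤ 2 * m) (h : Beats m i j) :
    ¬ Beats m j i := by
  unfold Beats at *; omega

theorem Beats.ne {m i j : ℕ} (h : Beats m i j) : i ≠ j := by
  unfold Beats at h; omega

variable {α : Type*}

open scoped Classical in
theorem card_filter_beats_le {m i : ℕ} (hi : i ≤ 2 * m) {X : Finset α} {f : α → ℕ}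
    (hf : Set.InjOn f X) (hm : ∀ x ∈ X, f x ≤ 2 * m) :
    (X.filter fun b => Beats m i (f b)).card ≤ m := by
  rw [← Finset.card_image_of_injOn (hf.mono (Finset.coe_subset.2 (Finset.filter_subset _ _)))]
  -- These are the m positions after i modulo 2m + 1, cut in two where they wrap around.
  have : (X.filter fun b => Beats m i (f b)).image f ⊆
      Finset.Ioc i (min (i + m) (2 * m)) ∪ Finset.range (i - m) := by
    intro j hj
    simp only [Finset.mem_image, Finset.mem_filter] at hj
    obtain ⟨b, ⟨hb, h⟩, rfl⟩ := hj
    have := hm b hb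
    unfold Beats at h
    simp only [Finset.mem_union, Finset.mem_Ioc, Finset.mem_range]
    omega
  refine (Finset.card_le_card this).trans ((Finset.card_union_le _ _).trans ?_)
  simp only [Nat.card_Ioc, Finset.card_range]
  omega

open scoped Classical in
theorem card_filter_beaten_le {m i : ℕ} (hi : i ≤ 2 * m) {X : Finset α} {f : α → ℕ}
    (hf : Set.InjOn f X) (hm : ∀ x ∈ X, f x ≤ 2 * m) :
    (X.filter fun b => Beats m (f b) i).card ≤ m := by
  rw [← Finset.card_image_of_injOn (hf.mono (Finset.coe_subset.2 (Finset.filter_subset _ _)))]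
  have : (X.filter fun b => Beats m (f b) i).image f ⊆
      Finset.Ico (i - m) i ∪ Finset.Ioc (i + m) (2 * m) := by
    intro j hj
    simp only [Finset.mem_image, Finset.mem_filter] at hj
    obtain ⟨b, ⟨hb, h⟩, rfl⟩ := hj
    have := hm b hb
    unfold Beats at h
    simp only [Finset.mem_union, Finset.mem_Ioc, Finset.mem_Ico]
    omega
  refine (Finset.card_le_card this).trans ((Finset.card_union_le _ _).trans ?_)
  simp only [Nat.card_Ioc, Nat.card_Ico]
  omega

/-- The elements of a set `X` of at most `2m + 1` elements can be placed in the circular tournament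
such that a given element `p` is beaten by all elements of a given set `S` of size at most `m`. -/
theorem exists_position {m : ℕ} {X S : Finset α} {p : α} (hX : X.card ≤ 2 * m + 1) (hp : p ∈ X)
    (hS : S ⊆ X) (hpS : p ∉ S) (hSm : S.card ≤ m) :
    ∃ f : α → ℕ, Set.InjOn f X ∧ (∀ x ∈ X, f x ≤ 2 * m) ∧ ∀ s ∈ S, Beats m (f s) (f p) := by
  classical
  have hS1 : S ⊆ X.erase p := fun x hx =>
    Finset.mem_erase.2 ⟨fun h => hpS (h ▸ hx), hS hx⟩
  have hc : (X.erase p).card = X.card - 1 := Finset.card_erase_of_mem hp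
  -- S is enlarged as far as m allows, so that the remaining elements R number at most m. Then p
  -- takes the position 2m, S' takes positions from m to 2m - 1, all of which beat 2m, and R takes
  -- positions below m.
  obtain ⟨S', hSS', hS'X, hcard⟩ := Finset.exists_subsuperset_card_eq hS1
    (n := min m (X.erase p).card) (le_min hSm (Finset.card_le_card hS1)) (min_le_right _ _)
  set R := X.erase p \ S' with hR
  have hRc : R.card ≤ m := by
    rw [hR, Finset.card_sdiff_of_subset hS'X]; omega
  have hS'm : S'.card ≤ m := by omega
  let f : α → ℕ := fun x =>
    if h : x ∈ S' then m + (S'.equivFin ⟨x, h⟩ : ℕ)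
    else if h : x ∈ R then (R.equivFin ⟨x, h⟩ : ℕ) else 2 * m
  have hfS : ∀ x (h : x ∈ S'), f x = m + (S'.equivFin ⟨x, h⟩ : ℕ) := fun x h => by simp [f, h]
  have hfR : ∀ x (h : x ∈ R), f x = (R.equivFin ⟨x, h⟩ : ℕ) := fun x h => by
    have : x ∉ S' := (Finset.mem_sdiff.1 h).2
    simp [f, h, this]
  have hpS' : p ∉ S' := fun h => by simpa using hS'X h
  have hpR : p ∉ R := fun h => by simp [hR] at h
  have hfp : f p = 2 * m := by simp [f, hpS', hpR]
  have cases : ∀ x ∈ X, x = p ∨ x ∈ S' ∨ x ∈ R := by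
    intro x hx
    by_cases h1 : x = p
    · exact .inl h1
    · by_cases h2 : x ∈ S'
      · exact .inr (.inl h2)
      · exact .inr (.inr (Finset.mem_sdiff.2 ⟨Finset.mem_erase.2 ⟨h1, hx⟩, h2⟩))
  have bS : ∀ x ∈ S', m ≤ f x ∧ f x < 2 * m := fun x h => by
    have := (S'.equivFin ⟨x, h⟩).2
    rw [hfS x h]; omega
  have bR : ∀ x ∈ R, f x < m := fun x h => by
    have := (R.equivFin ⟨x, h⟩).2
    rw [hfR x h]; omega
  refine ⟨f, ?_, ?_, ?_⟩
  · intro x hx y hy hxy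
    rcases cases x hx with rfl | h1 | h1 <;> rcases cases y hy with rfl | h2 | h2
    · rfl
    · have := bS y h2; omega
    · have := bR y h2; omega
    · have := bS x h1; omega
    · rw [hfS x h1, hfS y h2] at hxy
      have := S'.equivFin.injective (Fin.ext (Nat.add_left_cancel hxy))
      exact congrArg Subtype.val this
    · have := bS x h1; have := bR y h2; omega
    · have := bR x h1; omega
    · have := bR x h1; have := bS y h2; omega
    · rw [hfR x h1, hfR y h2] at hxy
      exact congrArg Subtype.val (R.equivFin.injective (Fin.ext hxy))
  · intro x hx
    rcases cases x hx with rfl | h1 | h1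
    · omega
    · exact (bS x h1).2.le
    · have := bR x h1; omega
  · intro s hs
    have := bS s (hSS' hs)
    unfold Beats; omega

end Tournament

/-! ### Coloring a cycle from lists of three colors. -/

section CycleLists

/-- Extending a linear sequence periodically, when no bichromatic window is created. -/
theorem exists_periodic_extension {n : ℕ} (hn : 4 ≤ n) (h : ℕ → ℕ)
    (h1 : ∀ i, i + 1 < n → h i ≠ h (i + 1)) (h1' : h (n - 1) ≠ h 0)
    (h2 : ∀ i, i + 3 < n → h i = h (i + 2) → h (i + 1) ≠ h (i + 3))
    (w1 : h (n - 3) = h (n - 1) → h (n - 2) ≠ h 0)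
    (w2 : h (n - 2) = h 0 → h (n - 1) ≠ h 1)
    (w3 : h (n - 1) = h 1 → h 0 ≠ h 2) :
    (∀ i, h (i % n) ≠ h ((i + 1) % n)) ∧
      ∀ i, h (i % n) = h ((i + 2) % n) → h ((i + 1) % n) ≠ h ((i + 3) % n) := by
  have hlt : ∀ i, i % n < n := fun i => Nat.mod_lt _ (by omega)
  have step : ∀ i k, k < 4 → (i + k) % n = if i % n + k < n then i % n + k else i % n + k - n := by
    intro i k hk
    have := hlt i
    rw [Nat.add_mod, Nat.mod_eq_of_lt (show k < n by omega)]
    split_ifs with hh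
    · exact Nat.mod_eq_of_lt hh
    · rw [Nat.mod_eq_sub_mod (by omega), Nat.mod_eq_of_lt (by omega)]
  constructor
  · intro i
    rw [step i 1 (by omega)]
    have := hlt i
    generalize i % n = j at *
    split_ifs with hh
    · exact h1 j hh
    · obtain rfl : j = n - 1 := by omega
      rwa [show n - 1 + 1 - n = 0 by omega]
  · intro i
    rw [step i 1 (by omega), step i 2 (by omega), step i 3 (by omega)]
    have := hlt i
    generalize i % n = j at *
    by_cases c3 : j + 3 < n
    · rw [if_pos (by omega), if_pos (by omega), if_pos (by omega)]
      exact h2 j c3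
    by_cases c2 : j + 2 < n
    · obtain rfl : j = n - 3 := by omega
      rw [if_pos (by omega), if_pos (by omega), if_neg (by omega)]
      rw [show n - 3 + 2 = n - 1 by omega, show n - 3 + 1 = n - 2 by omega,
        show n - 3 + 3 - n = 0 by omega]
      exact w1
    by_cases c1 : j + 1 < n
    · obtain rfl : j = n - 2 := by omega
      rw [if_neg (by omega), if_pos (by omega), if_neg (by omega)]
      rw [show n - 2 + 2 - n = 0 by omega, show n - 2 + 1 = n - 1 by omega,
        show n - 2 + 3 - n = 1 by omega]
      exact w2
    · obtain rfl : j = n - 1 := by omega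
      rw [if_neg (by omega), if_neg (by omega), if_neg (by omega)]
      rw [show n - 1 + 2 - n = 1 by omega, show n - 1 + 1 - n = 0 by omega,
        show n - 1 + 3 - n = 2 by omega]
      exact w3

theorem exists_cyclic_pattern {n : ℕ} (hn : 8 ≤ n) :
    ∃ g : ℕ → ℕ, (∀ i, g i < 3) ∧ (∀ i, g (i + n) = g i) ∧ (∀ i, g i ≠ g (i + 1)) ∧
      ∀ i, g i = g (i + 2) → g (i + 1) ≠ g (i + 3) := by
  obtain ⟨h, hlt, h1, h1', h2, w1, w2, w3⟩ : ∃ h : ℕ → ℕ, (∀ i, h i < 3) ∧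
      (∀ i, i + 1 < n → h i ≠ h (i + 1)) ∧ h (n - 1) ≠ h 0 ∧
      (∀ i, i + 3 < n → h i = h (i + 2) → h (i + 1) ≠ h (i + 3)) ∧
      (h (n - 3) = h (n - 1) → h (n - 2) ≠ h 0) ∧ (h (n - 2) = h 0 → h (n - 1) ≠ h 1) ∧
      (h (n - 1) = h 1 → h 0 ≠ h 2) := by
    -- The word 012 is repeated. For n ≡ 1 a final letter 1 is added, and for n ≡ 2 the repetitions
    -- are preceded by 01210121, which is where n ≥ 8 is needed.
    have : n % 3 = 0 ∨ n % 3 = 1 ∨ n % 3 = 2 := by omega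
    rcases this with h | h | h
    · refine ⟨fun i => i % 3, ?_, ?_, ?_, ?_, ?_, ?_, ?_⟩ <;> intros <;> dsimp only at * <;> omega
    · refine ⟨fun i => if i < n - 1 then i % 3 else 1, ?_, ?_, ?_, ?_, ?_, ?_, ?_⟩ <;> intros <;>
        dsimp only at * <;> split_ifs at * <;> omega
    · refine ⟨fun i => if i < 8 then (if i % 2 = 1 then 1 else i % 4) else (i + 1) % 3,
        ?_, ?_, ?_, ?_, ?_, ?_, ?_⟩ <;> intros <;>
        dsimp only at * <;> split_ifs at * <;> omega
  obtain ⟨a, b⟩ := exists_periodic_extension (by omega) h h1 h1' h2 w1 w2 w3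
  exact ⟨fun i => h (i % n), fun i => hlt _, fun i => by simp, a, b⟩

theorem exists_mem_ne_ne {s : Finset ℕ} (hs : 3 ≤ s.card) (a b : ℕ) :
    ∃ x ∈ s, x ≠ a ∧ x ≠ b := by
  obtain ⟨x, hx, hn⟩ := Finset.exists_mem_notMem_of_card_lt_card
    (s := {a, b}) (t := s) (lt_of_le_of_lt Finset.card_le_two (by omega))
  exact ⟨x, hx, by simpa using hn⟩

/-- Starting with x at the edge 0, each edge is colored differently from the two edges before it.
The difficulty is closing the cycle, where an edge has too many neighbors for a list of three; it
helps that the last edge differs from x for free. -/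
theorem exists_cyclic_list_coloring_of_not_mem {n : ℕ} (hn : 6 ≤ n) (L : ℕ → Finset ℕ)
    (hL : ∀ i, 3 ≤ (L i).card) {x : ℕ} (hx : x ∈ L 0) (hx' : x ∉ L (n - 1)) :
    ∃ g : ℕ → ℕ, (∀ i, g (i + n) = g i) ∧ (∀ i < n, g i ∈ L i) ∧ (∀ i, g i ≠ g (i + 1)) ∧
      ∀ i, g i = g (i + 2) → g (i + 1) ≠ g (i + 3) := by
  choose pick pick_mem pick_left pick_right using fun i => exists_mem_ne_ne (hL i)
  let q : ℕ → ℕ × ℕ := fun i =>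
    Nat.rec (x, pick 1 x x) (fun i ab => (ab.2, pick (i + 2) ab.1 ab.2)) i
  let h : ℕ → ℕ := fun i => (q i).1
  have h0 : h 0 = x := rfl
  have h1 : h 1 = pick 1 x x := rfl
  have hs : ∀ i, h (i + 2) = pick (i + 2) (h i) (h (i + 1)) := fun i => rfl
  have mem : ∀ i, h i ∈ L i := by
    intro i
    match i with
    | 0 => exact hx
    | 1 => exact pick_mem _ _ _
    | i + 2 => rw [hs]; exact pick_mem _ _ _
  have ne1 : ∀ i, h i ≠ h (i + 1) := by
    intro i
    match i with
    | 0 => rw [zero_add, h0, h1]; exact (pick_left 1 x x).symm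
    | i + 1 => rw [hs]; exact (pick_right _ _ _).symm
  have ne2 : ∀ i, h i ≠ h (i + 2) := fun i => by rw [hs]; exact (pick_left _ _ _).symm
  -- The last two edges are chosen anew. Equal colors at distance two are now possible only for the
  -- pairs n - 4, n - 2 and n - 1, 1. The windows that begin with them are saved by z ≠ h (n - 3)
  -- and by h 0 ≠ h 2.
  let y := pick (n - 2) (h (n - 3)) x
  let z := pick (n - 1) (h (n - 3)) y
  let g : ℕ → ℕ := fun i => if i = n - 1 then z else if i = n - 2 then y else h i
  have gl : ∀ i, i + 2 < n → g i = h i := fun i hi => by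
    have : i ≠ n - 1 := by omega
    have : i ≠ n - 2 := by omega
    simp [g, *]
  have gz : g (n - 1) = z := by simp [g]
  have gy : g (n - 2) = y := by
    have : n - 2 ≠ n - 1 := by omega
    simp [g, this]
  have hy := pick_left (n - 2) (h (n - 3)) x
  have hyx : y ≠ x := pick_right (n - 2) (h (n - 3)) x
  have hz : z ≠ h (n - 3) := pick_left (n - 1) (h (n - 3)) y
  have hzy : z ≠ y := pick_right (n - 1) (h (n - 3)) y
  have hzx : z ≠ x := fun e => hx' (e ▸ pick_mem (n - 1) (h (n - 3)) y)
  have hyx : y ≠ x := pick_right (n - 2) (h (n - 3)) x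
  have g3 : g (n - 3) = h (n - 3) := gl _ (by omega)
  have g0 : g 0 = x := gl 0 (by omega)
  have g1 : g 1 = h 1 := gl 1 (by omega)
  have g2 : g 2 = h 2 := gl 2 (by omega)
  obtain ⟨a, b⟩ := exists_periodic_extension (n := n) (by omega) g
    (by
      intro i hi
      by_cases c1 : i + 3 < n
      · rw [gl _ (by omega), gl _ (by omega)]; exact ne1 i
      by_cases c2 : i + 2 < n
      · obtain rfl : i = n - 3 := by omega
        rw [g3, show n - 3 + 1 = n - 2 by omega, gy]; exact hy.symm
      · obtain rfl : i = n - 2 := by omega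
        rw [gy, show n - 2 + 1 = n - 1 by omega, gz]; exact hzy.symm)
    (by rw [gz, g0]; exact hzx)
    (by
      intro i hi e
      by_cases c1 : i + 4 < n
      · rw [gl _ (by omega), gl _ (by omega)] at e; exact absurd e (ne2 i)
      · obtain rfl : i = n - 4 := by omega
        rw [show n - 4 + 1 = n - 3 by omega, show n - 4 + 3 = n - 1 by omega, g3, gz]
        exact hz.symm)
    (by rw [g3, gz]; intro e; exact absurd e.symm hz)
    (by rw [gy, g0]; intro e; exact absurd e hyx)
    (by rw [g0, g2]; intro _; exact ne2 0)
  refine ⟨fun i => g (i % n), fun i => by simp, fun i hi => ?_, a, b⟩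
  dsimp only
  rw [Nat.mod_eq_of_lt hi]
  by_cases c1 : i + 2 < n
  · rw [gl i c1]; exact mem i
  by_cases c2 : i + 1 < n
  · obtain rfl : i = n - 2 := by omega
    rw [gy]; exact pick_mem _ _ _
  · obtain rfl : i = n - 1 := by omega
    rw [gz]; exact pick_mem _ _ _

/-- The edges of a cycle of length at least eight can be colored from lists of three colors such
that no four consecutive edges are bichromatic. -/
theorem exists_cyclic_list_coloring {n : ℕ} (hn : 8 ≤ n) (L : ℕ → Finset ℕ)
    (per : ∀ i, L (i + n) = L i) (hL : ∀ i, 3 ≤ (L i).card) :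
    ∃ g : ℕ → ℕ, (∀ i, g (i + n) = g i) ∧ (∀ i, g i ∈ L i) ∧ (∀ i, g i ≠ g (i + 1)) ∧
      ∀ i, g i = g (i + 2) → g (i + 1) ≠ g (i + 3) := by
  have per' : ∀ k i, L (i + n * k) = L i := by
    intro k i
    induction k with
    | zero => simp
    | succ k ih => rw [Nat.mul_succ, ← add_assoc, per, ih]
  -- Lists that decrease around a cycle are all equal, and then the pattern with three letters
  -- applies. Otherwise some list has a color that its predecessor lacks, and the cycle is cut open
  -- there.
  by_cases hsub : ∀ i, L (i + 1) ⊆ L i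
  · have anti : Antitone L := antitone_nat_of_succ_le hsub
    have eq : ∀ i, L i = L 0 := fun i => by
      refine le_antisymm (anti (Nat.zero_le i)) ?_
      have h := anti (show i ≤ 0 + n * i by nlinarith)
      rwa [per'] at h
    obtain ⟨g, glt, gper, g1, g2⟩ := exists_cyclic_pattern hn
    obtain ⟨t, ht, htc⟩ := Finset.exists_subset_card_eq (hL 0)
    let φ : ℕ → ℕ := fun j => if h : j < 3 then (t.equivFinOfCardEq htc).symm ⟨j, h⟩ else 0
    have hφ : ∀ j (h : j < 3), φ j = (t.equivFinOfCardEq htc).symm ⟨j, h⟩ := fun j h => by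
      simp [φ, h]
    have inj : ∀ i j, φ (g i) = φ (g j) → g i = g j := by
      intro i j h
      rw [hφ _ (glt i), hφ _ (glt j)] at h
      exact congrArg Fin.val ((t.equivFinOfCardEq htc).symm.injective (Subtype.ext h))
    refine ⟨fun i => φ (g i), fun i => by simp [gper], fun i => ?_,
      fun i h => g1 i (inj _ _ h), fun i h h' => g2 i (inj _ _ h) (inj _ _ h')⟩
    rw [eq]
    dsimp only
    rw [hφ _ (glt i)]
    exact ht (Subtype.prop _)
  · push Not at hsub
    obtain ⟨i₀, hi⟩ := hsub
    obtain ⟨x, hx, hx'⟩ := Finset.not_subset.1 hi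
    obtain ⟨g, gper, gL, g1, g2⟩ := exists_cyclic_list_coloring_of_not_mem (n := n) (by omega)
      (fun i => L (i + (i₀ + 1))) (fun i => hL _) (x := x) (by simpa [add_comm] using hx)
      (by
        rwa [show n - 1 + (i₀ + 1) = i₀ + n by omega, per])
    have gper' : ∀ i, g (i % n) = g i := fun i => Function.Periodic.map_mod_nat gper i
    -- Shifting by k undoes the shift by i₀ + 1, since the sum of the two is a multiple of n.
    let k := (i₀ + 1) * (n - 1)
    have hk : i₀ + 1 + k = n * (i₀ + 1) := by
      obtain ⟨n, rfl⟩ : ∃ m, n = m + 1 := ⟨n - 1, by omega⟩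
      simp only [k, Nat.add_sub_cancel]
      ring
    refine ⟨fun i => g (i + k), fun i => ?_, fun i => ?_, fun i => ?_, fun i => ?_⟩
    · dsimp only; rw [show i + n + k = i + k + n by omega, gper]
    · have h := gL ((i + k) % n) (Nat.mod_lt _ (by omega))
      have e : L ((i + k) % n + (i₀ + 1)) = L i := by
        rw [← per' ((i + k) / n), show (i + k) % n + (i₀ + 1) + n * ((i + k) / n) =
          i + (i₀ + 1 + k) by have := Nat.mod_add_div (i + k) n; omega, hk, per']
      rw [gper', e] at h
      exact h
    · have := g1 (i + k)
      rwa [show i + k + 1 = i + 1 + k by omega] at this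
    · have := g2 (i + k)
      rwa [show i + k + 1 = i + 1 + k by omega, show i + k + 2 = i + 2 + k by omega,
        show i + k + 3 = i + 3 + k by omega] at this

end CycleLists

/-! ### Parents in a rooted tree. -/

section Tree

variable {V : Type*} {T : SimpleGraph V}

/-- Shortest paths from r through a and through b are both the unique path to v, so they have the
same penultimate vertex. -/
theorem IsTree.eq_of_adj_of_dist (hT : T.IsTree) {r v a b : V} (ha : T.Adj v a) (hb : T.Adj v b)
    (hda : T.dist r v = T.dist r a + 1) (hdb : T.dist r v = T.dist r b + 1) : a = b := by
  obtain ⟨p, hp⟩ := hT.connected.exists_walk_length_eq_dist r a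
  obtain ⟨q, hq⟩ := hT.connected.exists_walk_length_eq_dist r b
  have hp' : (p.concat ha.symm).IsPath := Walk.isPath_of_length_eq_dist _ (by simp [hp, hda])
  have hq' : (q.concat hb.symm).IsPath := Walk.isPath_of_length_eq_dist _ (by simp [hq, hdb])
  have := (hT.existsUnique_path r v).unique hp' hq'
  have := congrArg Walk.penultimate this
  simpa using this

end Tree

/-! ### The cycle through the leaves. -/

section LeafCycle

variable {V : Type*} [Fintype V] {T C : SimpleGraph V}

open scoped Classical in
/-- A periodic enumeration of the leaves along the adjoint cycle. -/
theorem IsLeafCycle.exists_enumeration (h : IsLeafCycle T C) :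
    ∃ (n : ℕ) (v : ℕ → V), 3 ≤ n ∧ (∀ i j, v i = v j ↔ i % n = j % n) ∧
      (∀ x y, C.Adj x y ↔ ∃ i, s(x, y) = s(v i, v (i + 1))) ∧
      ∀ x, T.degree x = 1 ↔ ∃ i, v i = x := by
  obtain ⟨x₀, p, hp, hsupp, hedge⟩ := h
  have hl := hp.three_le_length
  have hlt : ∀ i, i % p.length < p.length := fun i => Nat.mod_lt _ (by omega)
  have hv : ∀ i, i ≤ p.length → p.getVert (i % p.length) = p.getVert i := by
    intro i hi
    rcases hi.lt_or_eq with h | rfl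
    · rw [Nat.mod_eq_of_lt h]
    · simp
  have hsucc : ∀ i, p.getVert ((i + 1) % p.length) = p.getVert (i % p.length + 1) := by
    intro i
    rw [Nat.add_mod, Nat.mod_eq_of_lt (show 1 < p.length by omega)]
    exact hv _ (hlt i)
  refine ⟨p.length, fun i => p.getVert (i % p.length), hl, fun i j => ?_, fun x y => ?_,
    fun x => ?_⟩
  · refine ⟨fun h => ?_, fun h => by simp only [h]⟩
    refine hp.getVert_injOn' ?_ ?_ h
    · have := hlt i; simp only [Set.mem_ofPred_eq]; omega
    · have := hlt j; simp only [Set.mem_ofPred_eq]; omega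
  · constructor
    · intro h
      have h := hedge s(x, y) h
      rw [← Walk.adj_toSubgraph_iff_mem_edges, Walk.toSubgraph_adj_iff] at h
      obtain ⟨i, hi, hil⟩ := h
      refine ⟨i, ?_⟩
      dsimp only
      rw [hsucc, Nat.mod_eq_of_lt hil, hi]
    · rintro ⟨i, h⟩
      dsimp only at h
      rw [hsucc] at h
      have := p.adj_getVert_succ (hlt i)
      rw [← mem_edgeSet] at this ⊢
      rwa [h]
  · rw [← hsupp, Walk.mem_support_iff_exists_getVert]
    constructor
    · rintro ⟨i, rfl, hi⟩
      exact ⟨i, hv i hi⟩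
    · rintro ⟨i, rfl⟩
      exact ⟨_, rfl, (hlt i).le⟩


open scoped Classical in
theorem IsLeafCycle.degree_eq_one_of_adj (h : IsLeafCycle T C) {x y : V} (hxy : C.Adj x y) :
    T.degree x = 1 := by
  obtain ⟨n, v, -, -, hC, hleaf⟩ := h.exists_enumeration
  obtain ⟨i, hi⟩ := (hC x y).1 hxy
  rw [hleaf]
  rcases Sym2.eq_iff.1 hi with ⟨h, -⟩ | ⟨h, -⟩
  exacts [⟨_, h.symm⟩, ⟨_, h.symm⟩]

open scoped Classical in
/-- Every leaf has two neighbors on the adjoint cycle. -/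
theorem IsLeafCycle.exists_two_adj (h : IsLeafCycle T C) {x : V} (hx : T.degree x = 1) :
    ∃ y z, y ≠ z ∧ C.Adj x y ∧ C.Adj x z := by
  obtain ⟨n, v, hn, hv, hC, hleaf⟩ := h.exists_enumeration
  obtain ⟨i, rfl⟩ := (hleaf x).1 hx
  refine ⟨v (i + 1), v (i + (n - 1)), ?_, (hC _ _).2 ⟨i, rfl⟩, (hC _ _).2 ⟨i + (n - 1), ?_⟩⟩
  · rw [Ne, hv]
    intro e
    have e : 1 ≡ n - 1 [MOD n] := Nat.ModEq.add_left_cancel' i e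
    rw [Nat.ModEq, Nat.mod_eq_of_lt (by omega), Nat.mod_eq_of_lt (by omega)] at e
    have h2 : n = 2 := by omega
    omega
  · rw [Sym2.eq_swap]
    have : v i = v (i + (n - 1) + 1) := by
      rw [hv, show i + (n - 1) + 1 = i + n by omega, Nat.add_mod_right]
    rw [this]

-- Two adjacent leaves would form a whole component, leaving no room for a vertex of degree three.
open scoped Classical in
theorem IsTree.degree_ne_one_of_adj_of_degree_eq_one (hT : T.IsTree) (h3 : 3 ≤ T.maxDegree)
    {x y : V} (hxy : T.Adj x y) (hx : T.degree x = 1) : T.degree y ≠ 1 := by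
  intro hy
  have unique : ∀ {a b : V}, T.Adj a b → T.degree a = 1 → ∀ c, T.Adj a c → c = b := by
    intro a b hab ha c hac
    obtain ⟨d, hd⟩ := Finset.card_eq_one.1 ha
    have h1 : b ∈ ({d} : Finset V) := hd ▸ (mem_neighborFinset _ _ _).2 hab
    have h2 : c ∈ ({d} : Finset V) := hd ▸ (mem_neighborFinset _ _ _).2 hac
    simp_all
  have : Nonempty V := ⟨x⟩
  obtain ⟨w, hw⟩ := T.exists_maximal_degree_vertex
  have hwS : w ∉ ({x, y} : Set V) := by
    rintro (rfl | rfl) <;> omega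
  obtain ⟨p⟩ := hT.connected x w
  obtain ⟨d, -, hd1, hd2⟩ := p.exists_boundary_dart {x, y} (by simp) hwS
  rcases hd1 with h | h
  · exact hd2 (.inr (unique hxy hx _ (h ▸ d.adj)))
  · exact hd2 (.inl (unique hxy.symm hy _ (h ▸ d.adj)))

open scoped Classical in
theorem IsLeafCycle.disjoint (h : IsLeafCycle T C) (hT : T.IsTree) (h3 : 3 ≤ T.maxDegree) {x y : V}
    (hC : C.Adj x y) : ¬ T.Adj x y := fun hxy =>
  hT.degree_ne_one_of_adj_of_degree_eq_one h3 hxy (h.degree_eq_one_of_adj hC)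
    (h.degree_eq_one_of_adj hC.symm)

-- The tree has |V| - 1 edges, and none of them lies on C because no two leaves are adjacent in T.
-- Combined with Euler's formula, this count determines the number of faces.
open scoped Classical in
theorem card_edgeSet_sup_of_isLeafCycle (h : IsLeafCycle T C) (hT : T.IsTree)
    (h3 : 3 ≤ T.maxDegree) :
    Nat.card (T ⊔ C).edgeSet + 1 = Nat.card V + Nat.card C.edgeSet := by
  have hdisj : Disjoint T.edgeSet C.edgeSet := by
    rw [Set.disjoint_left]
    intro e
    induction e with
    | h x y => exact fun hT' hC => h.disjoint hT h3 hC hT'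
  have h1 : Nat.card T.edgeSet + 1 = Nat.card V := (isTree_iff_connected_and_card.1 hT).2
  have h2 : Nat.card (T ⊔ C).edgeSet = Nat.card T.edgeSet + Nat.card C.edgeSet := by
    rw [edgeSet_sup, Nat.card_coe_set_eq, Nat.card_coe_set_eq, Nat.card_coe_set_eq]
    exact Set.ncard_union_eq hdisj (Set.toFinite _) (Set.toFinite _)
  omega

end LeafCycle

/-! ### Facial walks of a rotation system. -/

section Faces

namespace RotationSystem

variable {V : Type*} {G : SimpleGraph V} (σ : G.RotationSystem)

theorem facePerm_apply (d : G.Dart) : σ.facePerm d = σ.next d.symm := rfl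

theorem fst_next (d : G.Dart) : (σ.next d).fst = d.fst :=
  (σ.sameCycle_iff _ _).1 ((Equiv.Perm.sameCycle_apply_left).2 (Equiv.Perm.SameCycle.refl _ _))

theorem fst_facePerm (d : G.Dart) : (σ.facePerm d).fst = d.snd := by
  rw [facePerm_apply, fst_next]; rfl

theorem next_ne {d : G.Dart} (h : ∃ w, G.Adj d.fst w ∧ w ≠ d.snd) : σ.next d ≠ d := by
  intro hd
  obtain ⟨w, hw, hne⟩ := h
  have : σ.next.SameCycle d ⟨(d.fst, w), hw⟩ := (σ.sameCycle_iff _ _).2 rfl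
  have := this.eq_of_left hd
  exact hne (congrArg (fun e : G.Dart => e.snd) this).symm

theorem faceOf_eq_iff {d e : G.Dart} : σ.faceOf d = σ.faceOf e ↔ σ.facePerm.SameCycle d e :=
  Quotient.eq (r := Equiv.Perm.SameCycle.setoid σ.facePerm)

theorem faceOf_facePerm (d : G.Dart) : σ.faceOf (σ.facePerm d) = σ.faceOf d :=
  σ.faceOf_eq_iff.2 ((Equiv.Perm.sameCycle_apply_left).2 (Equiv.Perm.SameCycle.refl _ _))

/-- A facial walk that leaves a set of vertices enters it again. -/
theorem exists_entering_dart [Finite V] (S : Set V) {d : G.Dart} (h1 : d.fst ∈ S)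
    (h2 : d.snd ∉ S) : ∃ e : G.Dart, σ.faceOf e = σ.faceOf d ∧ e.fst ∉ S ∧ e.snd ∈ S := by
  by_contra! hcon
  -- Without an entering dart the walk would remain outside S for ever, but it is periodic and comes
  -- back to d.
  have stay : ∀ k : ℕ, ((σ.facePerm ^ k) (σ.facePerm d)).fst ∉ S ∧
      σ.faceOf ((σ.facePerm ^ k) (σ.facePerm d)) = σ.faceOf d := by
    intro k
    induction k with
    | zero => exact ⟨by simpa [fst_facePerm] using h2, by simpa using σ.faceOf_facePerm d⟩
    | succ k ih =>
      rw [pow_succ', Equiv.Perm.mul_apply, fst_facePerm, faceOf_facePerm]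
      exact ⟨hcon _ ih.2 ih.1, ih.2⟩
  have : Finite G.Dart := Finite.of_injective (fun d : G.Dart => d.toProd)
    fun _ _ h => Dart.ext _ _ h
  obtain ⟨k, -, hk⟩ := (σ.faceOf_eq_iff.1 (σ.faceOf_facePerm d)).exists_pow_eq'
  have := (stay k).1
  rw [hk] at this
  exact this h1

end RotationSystem

end Faces

/-! ### Faces of a generalized Halin graph and cuts of its cycle. -/

section PlaneHalin

variable {V : Type*} [Fintype V] {H T C : SimpleGraph V}

theorem IsGeneralizedHalin.adj_or_adj (h : H.IsGeneralizedHalin T C) {x y : V} (hxy : H.Adj x y) :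
    T.Adj x y ∨ C.Adj x y := by
  rw [h.eq_sup] at hxy
  exact hxy

open scoped Classical in
theorem IsLeafCycle.exists_adj_ne (hC : IsLeafCycle T C) {x y : V}
    (hxy : (T ⊔ C).Adj x y) : ∃ w, (T ⊔ C).Adj x w ∧ w ≠ y := by
  by_cases hx : T.degree x = 1
  · obtain ⟨a, b, hab, ha, hb⟩ := hC.exists_two_adj hx
    by_cases hay : a = y
    · exact ⟨b, .inr hb, fun e => hab (hay.trans e.symm)⟩
    · exact ⟨a, .inr ha, hay⟩
  · have hxy' : T.Adj x y := hxy.resolve_right fun h' => hx (hC.degree_eq_one_of_adj h')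
    have : 1 < (T.neighborFinset x).card := by
      have : 0 < (T.neighborFinset x).card :=
        Finset.card_pos.2 ⟨y, (mem_neighborFinset _ _ _).2 hxy'⟩
      have : (T.neighborFinset x).card ≠ 1 := hx
      omega
    obtain ⟨w, hw, hne⟩ := Finset.exists_mem_ne this y
    exact ⟨w, .inl ((mem_neighborFinset _ _ _).1 hw), hne⟩

/-- Every facial walk of the union of a tree and a cycle through its leaves runs through an edge of
the cycle. -/
theorem IsLeafCycle.exists_cycle_dart (hC : IsLeafCycle T C) (hT : T.IsTree)
    (σ : (T ⊔ C).RotationSystem) (F : σ.Face) : ∃ d : (T ⊔ C).Dart, σ.faceOf d = F ∧ C.Adj d.fst d.snd := by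
  by_contra! hcon
  have hTd : ∀ d, σ.faceOf d = F → T.Adj d.fst d.snd := fun d hd =>
    (show T.Adj _ _ ∨ C.Adj _ _ from d.adj).resolve_right (hcon d hd)
  obtain ⟨d₀, hd₀⟩ := Quotient.exists_rep F
  have : Finite (T ⊔ C).Dart := Finite.of_injective (fun d : (T ⊔ C).Dart => d.toProd)
    fun _ _ h => Dart.ext _ _ h
  -- At a vertex of the walk farthest from a root, a walk inside the tree arrives from the parent
  -- and has to return to it. The rotation would then fix a dart, but every vertex of the union has
  -- at least two neighbors.
  obtain ⟨d, hd, hmax⟩ := Set.exists_max_image {d : (T ⊔ C).Dart | σ.faceOf d = F}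
    (fun d => T.dist d₀.fst d.snd) (Set.toFinite _) ⟨d₀, hd₀⟩
  have hd : σ.faceOf d = F := hd
  have h1 : σ.faceOf (σ.facePerm d) = F := (σ.faceOf_facePerm d).trans hd
  have h2 : σ.faceOf (σ.facePerm.symm d) = F := by
    rw [← hd, ← σ.faceOf_facePerm (σ.facePerm.symm d), Equiv.apply_symm_apply]
  have m1 : T.dist d₀.fst (σ.facePerm d).snd ≤ T.dist d₀.fst d.snd := hmax _ h1
  have m2 : T.dist d₀.fst (σ.facePerm.symm d).snd ≤ T.dist d₀.fst d.snd := hmax _ h2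
  rw [← σ.fst_facePerm, Equiv.apply_symm_apply] at m2
  have a1 : T.Adj d.snd (σ.facePerm d).snd := by
    have := hTd _ h1
    rwa [σ.fst_facePerm] at this
  have a2 : T.Adj d.snd d.fst := (hTd _ hd).symm
  have e := hT.eq_of_adj_of_dist (r := d₀.fst) a1 a2
    ((hT.dist_eq_dist_add_one_of_adj d₀.fst a1).resolve_right (by omega))
    ((hT.dist_eq_dist_add_one_of_adj d₀.fst a2).resolve_right (by omega))
  have : σ.next d.symm = d.symm := by
    refine Dart.ext _ _ (Prod.ext ?_ ?_)
    · exact σ.fst_next _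
    · exact e
  exact σ.next_ne (hC.exists_adj_ne d.symm.adj) this

theorem IsGeneralizedHalin.card_face (h : H.IsGeneralizedHalin T C) {σ : H.RotationSystem}
    (hσ : σ.IsPlane) : Nat.card σ.Face = Nat.card C.edgeSet + 1 := by
  classical
  have h1 := card_edgeSet_sup_of_isLeafCycle h.leafCycle h.isTree (by convert h.three_le_maxDegree)
  rw [← h.eq_sup] at h1
  have h2 := hσ.2
  omega

/-- Each face other than the exterior face has exactly one dart of the adjoint cycle, and the
exterior face has one dart of each edge of the adjoint cycle. -/
theorem IsGeneralizedHalin.cycle_dart_unique (h : H.IsGeneralizedHalin T C) {σ : H.RotationSystem}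
    (hσ : σ.IsPlane) {F : σ.Face} (hF : σ.boundary F = C.edgeSet) :
    (∀ d e : H.Dart, C.Adj d.fst d.snd → C.Adj e.fst e.snd → σ.faceOf d = σ.faceOf e →
      σ.faceOf d ≠ F → d = e) ∧
    ∀ d : H.Dart, C.Adj d.fst d.snd → σ.faceOf d = F → σ.faceOf d.symm ≠ F := by
  classical
  have hCH : C ≤ H := by rw [h.eq_sup]; exact le_sup_right
  have finD : Finite H.Dart :=
    Finite.of_injective (fun d : H.Dart => d.toProd) fun _ _ h => Dart.ext _ _ h
  have finF : Finite σ.Face := Quotient.finite _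
  have hg : ∀ F, ∃ d : H.Dart, σ.faceOf d = F ∧ C.Adj d.fst d.snd := by
    have hH := h.eq_sup
    clear hCH finD hF hσ
    subst hH
    exact h.leafCycle.exists_cycle_dart h.isTree σ
  choose g hg hgC using hg
  have hb : ∀ e : C.edgeSet, ∃ d : H.Dart, σ.faceOf d = F ∧ d.edge = e := by
    intro e
    exact hF.ge e.2
  choose b hbF hbe using hb
  have hbC : ∀ e, C.Adj (b e).fst (b e).snd := by
    intro e
    have := e.2
    rw [← hbe e] at this
    exact this
  -- One cycle dart is chosen on each face other than F, and one dart on F for each edge of C. This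
  -- is an injection between sets of the same size 2|C|, hence a bijection, so there are no cycle
  -- darts besides the chosen ones.
  let φ : {G : σ.Face // G ≠ F} ⊕ C.edgeSet → {d : H.Dart // C.Adj d.fst d.snd} :=
    Sum.elim (fun G => ⟨g G, hgC G⟩) (fun e => ⟨b e, hbC e⟩)
  have hφ : φ.Injective := by
    rintro (⟨G, hG⟩ | e) (⟨G', hG'⟩ | e') hh <;>
      simp only [φ, Sum.elim_inl, Sum.elim_inr, Subtype.mk.injEq] at hh
    · have := hg G
      rw [hh, hg] at this
      subst this; rfl
    · exact absurd ((hg G).symm.trans ((congrArg σ.faceOf hh).trans (hbF e'))) hG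
    · exact absurd ((hg G').symm.trans ((congrArg σ.faceOf hh.symm).trans (hbF e))) hG'
    · have := hbe e
      rw [hh, hbe] at this
      rw [Subtype.ext this]
  have cardC : Nat.card {d : H.Dart // C.Adj d.fst d.snd} = 2 * Nat.card C.edgeSet := by
    have e : {d : H.Dart // C.Adj d.fst d.snd} ≃ C.Dart :=
      { toFun := fun d => ⟨d.1.toProd, d.2⟩
        invFun := fun d => ⟨⟨d.toProd, hCH d.adj⟩, d.adj⟩
        left_inv := fun d => rfl
        right_inv := fun d => rfl }
    rw [Nat.card_congr e, Nat.card_eq_fintype_card, C.dart_card_eq_twice_card_edges,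
      Nat.card_eq_fintype_card, edgeFinset_card]
  have cardF : Nat.card {G : σ.Face // G ≠ F} = Nat.card C.edgeSet := by
    have h1 := h.card_face hσ
    have := Fintype.ofFinite σ.Face
    rw [Nat.card_eq_fintype_card] at h1 ⊢
    rw [Fintype.card_subtype_compl, Fintype.card_subtype_eq]
    omega
  have surj : φ.Surjective := (hφ.bijective_of_nat_card_le (by
    rw [cardC, Nat.card_sum, cardF]; omega)).2
  have inner : ∀ d : H.Dart, C.Adj d.fst d.snd → σ.faceOf d ≠ F → d = g (σ.faceOf d) := by
    intro d hd hdF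
    obtain ⟨(⟨G, hG⟩ | e), hh⟩ := surj ⟨d, hd⟩ <;>
      simp only [φ, Sum.elim_inl, Sum.elim_inr, Subtype.mk.injEq] at hh
    · subst hh; rw [hg]
    · exact absurd (hh ▸ hbF e) hdF
  have outer : ∀ d : H.Dart, C.Adj d.fst d.snd → σ.faceOf d = F → ∃ e, d = b e := by
    intro d hd hdF
    obtain ⟨(⟨G, hG⟩ | e), hh⟩ := surj ⟨d, hd⟩ <;>
      simp only [φ, Sum.elim_inl, Sum.elim_inr, Subtype.mk.injEq] at hh
    · exact absurd ((hg G).symm.trans (hh ▸ hdF)) hG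
    · exact ⟨e, hh.symm⟩
  refine ⟨fun d e hd he hde hdF => ?_, fun d hd hdF hdF' => ?_⟩
  · rw [inner d hd hdF, inner e he (hde ▸ hdF), hde]
  · obtain ⟨e, rfl⟩ := outer d hd hdF
    obtain ⟨e', he'⟩ := outer _ (show C.Adj (b e).symm.fst (b e).symm.snd from hd.symm) hdF'
    have : e = e' := by
      refine Subtype.ext ?_
      rw [← hbe e, ← hbe e', ← he', Dart.edge_symm]
    subst this
    exact Dart.symm_ne _ he'

/-- If a single edge of the characteristic tree joins a set `S` to its complement, then at most two
edges of the adjoint cycle do. -/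
theorem IsGeneralizedHalin.ncard_cycle_cut_le (h : H.IsGeneralizedHalin T C) {S : Set V} {u p : V}
    (hS : ∀ x ∈ S, ∀ y ∉ S, T.Adj x y → x = u ∧ y = p) :
    {q : V × V | C.Adj q.1 q.2 ∧ q.1 ∈ S ∧ q.2 ∉ S}.ncard ≤ 2 := by
  classical
  obtain ⟨σ, hσ, F, hF⟩ := h.embedding
  obtain ⟨uniq, outer⟩ := h.cycle_dart_unique hσ hF
  have hCH : C ≤ H := by rw [h.eq_sup]; exact le_sup_right
  -- An interior facial walk that enters S' along its only cycle dart has to leave S' along a tree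
  -- dart, which can only be the one from u' to p'. That dart lies on a single face, and this face
  -- has a single cycle dart.
  have one : ∀ (S' : Set V) (u' p' : V), (∀ x ∈ S', ∀ y ∉ S', T.Adj x y → x = u' ∧ y = p') →
      ∀ d e : H.Dart, C.Adj d.fst d.snd → C.Adj e.fst e.snd → σ.faceOf d ≠ F → σ.faceOf e ≠ F →
      d.fst ∉ S' → e.fst ∉ S' → d.snd ∈ S' → e.snd ∈ S' → d = e := by
    intro S' u' p' hS' d e hd he hdF heF d1 e1 d2 e2
    have aux : ∀ d : H.Dart, C.Adj d.fst d.snd → σ.faceOf d ≠ F → d.fst ∉ S' → d.snd ∈ S' →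
        ∃ t : H.Dart, σ.faceOf t = σ.faceOf d ∧ t.fst = u' ∧ t.snd = p' := by
      intro d hd hdF d1 d2
      obtain ⟨t, ht, t1, t2⟩ := σ.exists_entering_dart S'ᶜ d1 (by simpa using d2)
      refine ⟨t, ht, ?_⟩
      rcases h.adj_or_adj t.adj with hT | hC
      · exact hS' _ (by simpa using t1) _ t2 hT
      · have := uniq t d hC hd ht (ht ▸ hdF)
        subst this
        exact absurd t2 (by simpa using d2)
    obtain ⟨t, ht, t1, t2⟩ := aux d hd hdF d1 d2
    obtain ⟨t', ht', t1', t2'⟩ := aux e he heF e1 e2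
    have : t = t' := Dart.ext _ _ (Prod.ext (t1.trans t1'.symm) (t2.trans t2'.symm))
    subst this
    exact uniq d e hd he (ht.symm.trans ht') hdF
  let P := {q : V × V | C.Adj q.1 q.2 ∧ q.1 ∈ S ∧ q.2 ∉ S}
  let D : P → H.Dart := fun q => ⟨q.1, hCH q.2.1⟩
  -- A cut edge, directed out of S, either lies on F, and then its reversal is interior and enters
  -- S, or is itself interior and enters the complement. By `one` there is at most one cut edge of
  -- each kind.
  let ψ : P → Bool := fun q => decide (σ.faceOf (D q) = F)
  have hψ : ψ.Injective := by
    intro q q' hqq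
    simp only [ψ, decide_eq_decide] at hqq
    by_cases hq : σ.faceOf (D q) = F
    · have hq' := hqq.1 hq
      have := one S u p hS (D q).symm (D q').symm q.2.1.symm q'.2.1.symm (outer _ q.2.1 hq)
        (outer _ q'.2.1 hq') q.2.2.2 q'.2.2.2 q.2.2.1 q'.2.2.1
      have := Dart.symm_involutive.injective this
      exact Subtype.ext (congrArg Dart.toProd this)
    · have hq' := fun h' => hq (hqq.2 h')
      have := one Sᶜ p u (fun x hx y hy hxy => (hS y (by simpa using hy) x hx hxy.symm).symm)
        (D q) (D q') q.2.1 q'.2.1 hq hq' (by simpa using q.2.2.1) (by simpa using q'.2.2.1)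
        q.2.2.2 q'.2.2.2
      exact Subtype.ext (congrArg Dart.toProd this)
  have := Nat.card_le_card_of_injective ψ hψ
  rw [Nat.card_coe_set_eq] at this
  simpa using this

end PlaneHalin

/-! ### Hall's theorem for slightly shortened lists, and branches of a tree. -/

section Recoloring

variable {V : Type*} {T : SimpleGraph V}

/-- Hall's condition: every set A x has at least N - 2 elements, which settles families of at most N
- 2 members. A larger family has at least three members, so for one of them r x = 0 and already that
set has N elements. -/
theorem exists_injOn_of_sum_le_two {α : Type*} {X : Finset α} {A : α → Finset ℕ} {r : α → ℕ}
    {N : ℕ} (hN : 4 ≤ N) (hX : X.card ≤ N) (hA : ∀ x ∈ X, N ≤ (A x).card + r x)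
    (hr : ∑ x ∈ X, r x ≤ 2) : ∃ φ : α → ℕ, Set.InjOn φ X ∧ ∀ x ∈ X, φ x ∈ A x := by
  classical
  have hall : ∀ s : Finset X, s.card ≤ (s.biUnion fun x => A x).card := by
    intro s
    have hs : s.card ≤ N := (Finset.card_le_univ s).trans (by simpa using hX)
    have sub : ∀ x ∈ s, (A x).card ≤ (s.biUnion fun x => A x).card := fun x hx =>
      Finset.card_le_card (Finset.subset_biUnion_of_mem (fun x : X => A x) hx)
    have hr' : ∑ x ∈ s, r x ≤ 2 := by
      refine le_trans ?_ hr
      rw [← Finset.sum_coe_sort X]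
      exact Finset.sum_le_sum_of_subset (Finset.subset_univ s)
    by_cases h : s.card ≤ N - 2
    · rcases s.eq_empty_or_nonempty with rfl | ⟨x, hx⟩
      · simp
      · have h1 := sub x hx
        have h2 := hA x x.2
        have h3 : r x ≤ 2 := (Finset.single_le_sum (f := fun x : X => r x)
          (fun x _ => Nat.zero_le _) hx).trans hr'
        omega
    · obtain ⟨x, hx, h0⟩ : ∃ x ∈ s, r x = 0 := by
        by_contra! hcon
        have : s.card • 1 ≤ ∑ x ∈ s, r x :=
          Finset.card_nsmul_le_sum _ _ _ fun x hx => Nat.one_le_iff_ne_zero.2 (hcon x hx)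
        simp only [smul_eq_mul] at this
        omega
      have h1 := sub x hx
      have h2 := hA x x.2
      omega
  obtain ⟨φ, hφ, hmem⟩ := (Finset.all_card_le_biUnion_card_iff_exists_injective _).1 hall
  refine ⟨fun x => if h : x ∈ X then φ ⟨x, h⟩ else 0, ?_, ?_⟩
  · intro x hx y hy h
    have hx' : x ∈ X := hx
    have hy' : y ∈ X := hy
    simp only [hx', hy', dif_pos] at h
    exact congrArg Subtype.val (hφ h)
  · intro x hx
    simp only [hx, dif_pos]
    exact hmem ⟨x, hx⟩

/-- Changing the colors of some edges at a vertex. -/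
theorem exists_recoloring (c : Sym2 V → ℕ) (u : V) (X : Finset V) (φ : V → ℕ) :
    ∃ c' : Sym2 V → ℕ, (∀ b ∈ X, c' s(u, b) = φ b) ∧
      ∀ w a, w ≠ u → w ∉ X → c' s(w, a) = c s(w, a) := by
  classical
  refine ⟨fun e => if h : ∃ b ∈ X, e = s(u, b) then φ h.choose else c e, ?_, ?_⟩
  · intro b hb
    have h : ∃ b' ∈ X, s(u, b) = s(u, b') := ⟨b, hb, rfl⟩
    dsimp only
    rw [dif_pos h]
    exact congrArg φ (Sym2.congr_right.1 h.choose_spec.2).symm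
  · intro w a hw hwX
    dsimp only
    rw [dif_neg]
    rintro ⟨b, hb, h⟩
    rcases Sym2.eq_iff.1 h with ⟨h, -⟩ | ⟨h, -⟩
    · exact hw h
    · exact hwX (h ▸ hb)

/-- The branch of a tree at a neighbor `u` of a connected set `D`. -/
theorem IsTree.exists_branch (hT : T.IsTree) {D : Set V} {r : V}
    (hD : ∀ w ∈ D, ∃ q : T.Walk r w, ∀ x ∈ q.support, x ∈ D) {u p : V} (hu : u ∉ D) (hp : p ∈ D)
    (hup : T.Adj u p) :
    ∃ S : Set V, (∀ w ∈ D, w ∉ S) ∧ (∀ b, T.Adj u b → b ≠ p → b ∈ S) ∧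
      ∀ x ∈ S, ∀ y ∉ S, T.Adj x y → x = u ∧ y = p := by
  -- The edge up is a bridge, and S is the side of u after its deletion. The set D stays on the
  -- other side because it is connected without using u.
  have hbr := isBridge_iff.1 (isAcyclic_iff_forall_adj_isBridge.1 hT.isAcyclic hup)
  set T' := T.deleteEdges {s(u, p)} with hT'
  have hadj : ∀ {x y}, T.Adj x y → s(x, y) ≠ s(u, p) → T'.Adj x y := fun h hn => by
    rw [hT', deleteEdges_adj]
    exact ⟨h, hn⟩
  have reach : ∀ w ∈ D, T'.Reachable r w := by
    intro w hw
    obtain ⟨q, hq⟩ := hD w hw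
    refine ⟨q.toDeleteEdges _ ?_⟩
    rintro e he rfl
    exact hu (hq u (q.fst_mem_support_of_mem_edges he))
  have hDS : ∀ w ∈ D, ¬ T'.Reachable u w := fun w hw h =>
    hbr (h.trans ((reach w hw).symm.trans (reach p hp)))
  refine ⟨{x | T'.Reachable u x}, hDS, fun b hb hbp => (hadj hb ?_).reachable, ?_⟩
  · intro h
    exact hbp (Sym2.congr_right.1 h)
  · intro x hx y hy hxy
    by_cases h : s(x, y) = s(u, p)
    · rcases Sym2.eq_iff.1 h with h | ⟨-, rfl⟩
      · exact h
      · exact absurd (Reachable.refl _) hy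
    · exact absurd (Reachable.trans hx (hadj hxy h).reachable) hy

end Recoloring

/-! ### Coloring the tree outward from a root. -/

section TreeColoring

variable {V : Type*} {H T C : SimpleGraph V}

/-- A coloring of the edges of `T` at the vertices of `D`, together with positions `f u` of the
neighbors of each `u ∈ D` in the circular tournament: if `a` beats `b` at `u`, then the color of
`ub` does not occur at `a`. -/
structure IsTournamentColoring (T C : SimpleGraph V) (L : Sym2 V → Finset ℕ) (m : ℕ) (D : Set V)
    (c : Sym2 V → ℕ) (f : V → V → ℕ) : Prop where
  mem : ∀ u ∈ D, ∀ a, T.Adj u a → c s(u, a) ∈ L s(u, a)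
  proper : ∀ u ∈ D, ∀ a b, T.Adj u a → T.Adj u b → c s(u, a) = c s(u, b) → a = b
  inj : ∀ u ∈ D, ∀ a b, T.Adj u a → T.Adj u b → f u a = f u b → a = b
  le : ∀ u ∈ D, ∀ a, T.Adj u a → f u a ≤ 2 * m
  avoid : ∀ u ∈ D, ∀ a ∈ D, T.Adj u a → ∀ b, T.Adj u b → Beats m (f u a) (f u b) →
    ∀ a', T.Adj a a' → c s(a, a') ≠ c s(u, b)
  -- Here x and y are consecutive leaves on C, so their pendant edges receive different colors. The
  -- cycle edges are colored later and rely on this.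
  pendant : ∀ u ∈ D, ∀ w ∈ D, ∀ x y, T.Adj u x → T.Adj w y → C.Adj x y → c s(u, x) ≠ c s(w, y)

open scoped Classical in
/-- The colors of the edges at `u` that may not occur at the neighbor `a` of `u`. -/
noncomputable def beatenColors [Fintype V] (T : SimpleGraph V) (m : ℕ) (c : Sym2 V → ℕ)
    (f : V → V → ℕ) (u a : V) : Finset ℕ :=
  ((T.neighborFinset u).filter fun b => b = a ∨ Beats m (f u a) (f u b)).image fun b => c s(u, b)

variable [Fintype V]

theorem mem_beatenColors {m : ℕ} {c : Sym2 V → ℕ} {f : V → V → ℕ} {u a : V} {k : ℕ} :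
    k ∈ beatenColors T m c f u a ↔
      ∃ b, T.Adj u b ∧ (b = a ∨ Beats m (f u a) (f u b)) ∧ c s(u, b) = k := by
  classical
  simp [beatenColors, and_assoc]

theorem IsTournamentColoring.card_beatenColors_le {L : Sym2 V → Finset ℕ} {m : ℕ} {D : Set V}
    {c : Sym2 V → ℕ} {f : V → V → ℕ} (hc : IsTournamentColoring T C L m D c f) {u a : V}
    (hu : u ∈ D) (hua : T.Adj u a) : (beatenColors T m c f u a).card ≤ m + 1 := by
  classical
  refine Finset.card_image_le.trans ?_
  have : ((T.neighborFinset u).filter fun b => b = a ∨ Beats m (f u a) (f u b)) ⊆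
      insert a ((T.neighborFinset u).filter fun b => Beats m (f u a) (f u b)) := by
    intro b hb
    simp only [Finset.mem_filter, Finset.mem_insert] at hb ⊢
    tauto
  refine (Finset.card_le_card this).trans ((Finset.card_insert_le _ _).trans ?_)
  refine Nat.succ_le_succ (card_filter_beats_le (hc.le u hu a hua) ?_ ?_)
  · intro x hx y hy
    exact hc.inj u hu x y (by simpa using hx) (by simpa using hy)
  · intro x hx
    exact hc.le u hu x (by simpa using hx)

open scoped Classical in
theorem exists_leaf_neighbor (T : SimpleGraph V) :
    ∃ nb : V → V, ∀ y, T.degree y = 1 → T.Adj y (nb y) ∧ ∀ w, T.Adj y w → w = nb y := by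
  have : ∀ y, ∃ z, T.degree y = 1 → T.Adj y z ∧ ∀ w, T.Adj y w → w = z := by
    intro y
    by_cases hy : T.degree y = 1
    · obtain ⟨z, hz⟩ := Finset.card_eq_one.1 hy
      refine ⟨z, fun _ => ⟨?_, fun w hw => ?_⟩⟩
      · rw [← mem_neighborFinset, hz]; exact Finset.mem_singleton_self z
      · rw [← mem_neighborFinset, hz] at hw; exact Finset.mem_singleton.1 hw
    · exact ⟨y, fun h => absurd h hy⟩
  choose nb hnb using this
  exact ⟨nb, hnb⟩

-- The greedy step. Only the tournament conditions across the edge up are new: that of p is met by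
-- keeping beaten colors away from u, and that of u by choosing the position of p after the colors.
open scoped Classical in
theorem IsTournamentColoring.exists_insert (h : H.IsGeneralizedHalin T C) {Δ m : ℕ}
    (hΔ : ∀ v, T.degree v ≤ Δ) (hΔm : Δ ≤ 2 * m + 1) (h5 : 5 ≤ Δ) {L : Sym2 V → Finset ℕ}
    (hL : ∀ e, Δ + m ≤ (L e).card) {D : Set V} {c : Sym2 V → ℕ} {f : V → V → ℕ}
    (hc : IsTournamentColoring T C L m D c f) {r : V} (hDleaf : ∀ w ∈ D, T.degree w ≠ 1)
    (hD : ∀ w ∈ D, ∃ q : T.Walk r w, ∀ x ∈ q.support, x ∈ D) {u p : V} (hu : u ∉ D)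
    (huleaf : T.degree u ≠ 1) (hp : p ∈ D) (hup : T.Adj u p) :
    ∃ c' f', IsTournamentColoring T C L m (insert u D) c' f' := by
  obtain ⟨S, hDS, hbS, hcut⟩ := h.isTree.exists_branch hD hu hp hup
  obtain ⟨nb, hnb⟩ := exists_leaf_neighbor T
  have hCleaf : ∀ {x y}, C.Adj x y → T.degree x = 1 := h.leafCycle.degree_eq_one_of_adj
  set X := (T.neighborFinset u).erase p with hX
  have memX : ∀ {b}, b ∈ X ↔ b ≠ p ∧ T.Adj u b := by simp [hX]
  have uX : u ∉ X := fun hb => (memX.1 hb).2.ne rfl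
  have DX : ∀ w ∈ D, w ∉ X := fun w hw hb => hDS w hw (hbS w (memX.1 hb).2 (memX.1 hb).1)
  -- Leaves outside the branch that follow or precede the leaf b on C: the color of the pendant edge
  -- at each of them is forbidden for ub. By the cut bound there are at most two such pairs over all
  -- b.
  let Y : V → Finset V := fun b => Finset.univ.filter fun y => C.Adj b y ∧ y ∉ S
  let A : V → Finset ℕ := fun b =>
    (L s(u, b) \ beatenColors T m c f p u) \ (Y b).image fun y => c s(nb y, y)
  have cardX : X.card ≤ Δ - 1 := by
    rw [hX, Finset.card_erase_of_mem (by simpa using hup)]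
    exact Nat.sub_le_sub_right (hΔ u) 1
  -- Of the Δ + m colors, at most m + 1 are beaten colors.
  have cardA : ∀ b ∈ X, Δ - 1 ≤ (A b).card + (Y b).card := by
    intro b hb
    have h1 := hc.card_beatenColors_le hp hup.symm
    have h2 := hL s(u, b)
    have h3 := Finset.le_card_sdiff (beatenColors T m c f p u) (L s(u, b))
    have h4 := Finset.le_card_sdiff ((Y b).image fun y => c s(nb y, y))
      (L s(u, b) \ beatenColors T m c f p u)
    have h5 : ((Y b).image fun y => c s(nb y, y)).card ≤ (Y b).card := Finset.card_image_le
    simp only [A]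
    omega
  have cardY : ∑ b ∈ X, (Y b).card ≤ 2 := by
    rw [← Finset.card_sigma]
    refine le_trans ?_ (h.ncard_cycle_cut_le hcut)
    rw [Set.ncard_eq_toFinset_card']
    refine Finset.card_le_card_of_injOn (fun q => (q.1, q.2)) ?_ ?_
    · rintro ⟨b, y⟩ hq
      simp only [Finset.coe_sigma, Set.mem_sigma_iff, Finset.mem_coe, Y, Finset.mem_filter,
        Finset.mem_univ, true_and] at hq
      simp only [Set.coe_toFinset, Set.mem_ofPred_eq]
      exact ⟨hq.2.1, hbS b (memX.1 hq.1).2 (memX.1 hq.1).1, hq.2.2⟩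
    · rintro ⟨b, y⟩ - ⟨b', y'⟩ - hq
      simpa using hq
  obtain ⟨φ, hφ, hφA⟩ := exists_injOn_of_sum_le_two (by omega) cardX cardA cardY
  have φL : ∀ b ∈ X, φ b ∈ L s(u, b) := fun b hb =>
    (Finset.mem_sdiff.1 (Finset.mem_sdiff.1 (hφA b hb)).1).1
  have φbeaten : ∀ b ∈ X, φ b ∉ beatenColors T m c f p u := fun b hb =>
    (Finset.mem_sdiff.1 (Finset.mem_sdiff.1 (hφA b hb)).1).2
  have φpendant : ∀ b ∈ X, ∀ y, C.Adj b y → y ∉ S → φ b ≠ c s(nb y, y) := by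
    intro b hb y hy hyS e
    exact (Finset.mem_sdiff.1 (hφA b hb)).2
      (Finset.mem_image.2 ⟨y, Finset.mem_filter.2 ⟨Finset.mem_univ y, hy, hyS⟩, e.symm⟩)
  obtain ⟨c', hc'u, hc'⟩ := exists_recoloring c u X φ
  have c'D : ∀ w ∈ D, ∀ a, c' s(w, a) = c s(w, a) := fun w hw a =>
    hc' w a (fun e => hu (e ▸ hw)) (DX w hw)
  have c'p : c' s(u, p) = c s(p, u) := by rw [Sym2.eq_swap, c'D p hp]
  -- The neighbors b whose new color also occurs at p. Such a color is not beaten, so it belongs to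
  -- an edge pa such that a beats u at p, whence |Q| ≤ m. At u, all of Q will beat p, and the
  -- condition on p becomes vacuous for them.
  set Q := X.filter fun b => φ b ∈ (T.neighborFinset p).image fun a => c s(p, a) with hQ
  have cardQ : Q.card ≤ m := by
    rw [← Finset.card_image_of_injOn
      (hφ.mono (Finset.coe_subset.2 (Finset.filter_subset _ _)) : Set.InjOn φ Q)]
    have : Q.image φ ⊆ ((T.neighborFinset p).filter fun a => Beats m (f p a) (f p u)).image
        fun a => c s(p, a) := by
      intro k hk
      obtain ⟨b, hb, rfl⟩ := Finset.mem_image.1 hk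
      obtain ⟨hbX, hb⟩ := Finset.mem_filter.1 hb
      obtain ⟨a, ha, hab⟩ := Finset.mem_image.1 hb
      have hpa : T.Adj p a := by simpa using ha
      have hn := φbeaten b hbX
      rw [mem_beatenColors] at hn
      refine Finset.mem_image.2 ⟨a, Finset.mem_filter.2 ⟨ha, ?_⟩, hab⟩
      by_cases hau : a = u
      · exact absurd ⟨a, hpa, .inl hau, hab⟩ hn
      · refine (beats_or_beats m fun e => hau (hc.inj p hp _ _ hpa hup.symm e)).resolve_right ?_
        exact fun hb => hn ⟨a, hpa, .inr hb, hab⟩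
    refine (Finset.card_le_card this).trans (Finset.card_image_le.trans
      (card_filter_beaten_le (hc.le p hp u hup.symm) ?_ ?_))
    · intro x hx y hy
      exact hc.inj p hp x y (by simpa using hx) (by simpa using hy)
    · intro x hx
      exact hc.le p hp x (by simpa using hx)
  obtain ⟨g, ginj, gle, gbeat⟩ := exists_position (m := m) (X := T.neighborFinset u) (S := Q)
    (p := p) ((hΔ u).trans hΔm) (by simpa using hup)
    ((Finset.filter_subset _ _).trans (Finset.erase_subset _ _))
    (fun hq => (memX.1 (Finset.mem_filter.1 hq).1).1 rfl) cardQ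
  have onlyp : ∀ w ∈ D, T.Adj u w → w = p := by
    intro w hw huw
    by_contra hwp
    exact hDS w hw (hbS w huw hwp)
  have f'D : ∀ w ∈ D, Function.update f u g w = f w := fun w hw =>
    Function.update_of_ne (fun e : w = u => hu (e ▸ hw)) _ _
  have proper_u : ∀ a b, T.Adj u a → T.Adj u b → c' s(u, a) = c' s(u, b) → a = b := by
    have aux : ∀ b, b ∈ X → c' s(u, p) ≠ c' s(u, b) := by
      intro b hb e
      rw [c'p, hc'u b hb] at e
      exact φbeaten b hb (mem_beatenColors.2 ⟨u, hup.symm, .inl rfl, e⟩)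
    intro a b ha hb e
    by_cases hap : a = p
    · by_cases hbp : b = p
      · rw [hap, hbp]
      · exact absurd (hap ▸ e) (aux b (memX.2 ⟨hbp, hb⟩))
    · by_cases hbp : b = p
      · exact absurd (hbp ▸ e.symm) (aux a (memX.2 ⟨hap, ha⟩))
      · have haX := memX.2 ⟨hap, ha⟩
        have hbX := memX.2 ⟨hbp, hb⟩
        rw [hc'u a haX, hc'u b hbX] at e
        exact hφ haX hbX e
  have pendant_u : ∀ w ∈ D, ∀ x y, T.Adj u x → T.Adj w y → C.Adj x y →
      c' s(u, x) ≠ c' s(w, y) := by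
    intro w hw x y hx hy hxy
    have hxX : x ∈ X := memX.2 ⟨fun e => hDleaf p hp (e ▸ hCleaf hxy), hx⟩
    -- If y were in S, then its edge to w ∈ D would be the only crossing edge up, and the leaf y
    -- would be the inner vertex u.
    have hyS : y ∉ S := fun hyS => huleaf <| by
      rw [← (hcut y hyS w (hDS w hw) hy.symm).1]
      exact hCleaf hxy.symm
    rw [hc'u x hxX, c'D w hw, (hnb y (hCleaf hxy.symm)).2 w hy.symm]
    exact φpendant x hxX y hxy hyS
  refine ⟨c', Function.update f u g, ?_, ?_, ?_, ?_, ?_, ?_⟩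
  · rintro w (rfl | hw) a ha
    · by_cases hap : a = p
      · subst hap
        rw [c'p, Sym2.eq_swap]
        exact hc.mem a hp w ha.symm
      · rw [hc'u a (memX.2 ⟨hap, ha⟩)]
        exact φL a (memX.2 ⟨hap, ha⟩)
    · rw [c'D w hw]; exact hc.mem w hw a ha
  · rintro w (rfl | hw) a b ha hb
    · exact proper_u a b ha hb
    · rw [c'D w hw, c'D w hw]; exact hc.proper w hw a b ha hb
  · rintro w (rfl | hw) a b ha hb
    · rw [Function.update_self]
      exact fun e => ginj (by simpa using ha) (by simpa using hb) e
    · rw [f'D w hw]; exact hc.inj w hw a b ha hb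
  · rintro w (rfl | hw) a ha
    · rw [Function.update_self]; exact gle a (by simpa using ha)
    · rw [f'D w hw]; exact hc.le w hw a ha
  · rintro w (rfl | hw) a (rfl | ha) hwa b hb hbeat a' ha'
    · exact absurd rfl hwa.ne
    · obtain rfl := onlyp a ha hwa
      rw [Function.update_self] at hbeat
      have hbX : b ∈ X := memX.2 ⟨fun e => hbeat.ne (by rw [e]), hb⟩
      rw [c'D a ha, hc'u b hbX]
      intro e
      have : b ∈ Q := Finset.mem_filter.2 ⟨hbX, Finset.mem_image.2 ⟨a', by simpa using ha', e⟩⟩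
      exact hbeat.not_beats (gle a (by simpa using hwa)) (gbeat b this)
    · obtain rfl := onlyp w hw hwa.symm
      rw [f'D w hw] at hbeat
      rw [c'D w hw]
      by_cases hap : a' = w
      · subst hap
        rw [c'p]
        exact fun e => hbeat.ne (by rw [hc.proper a' hw _ _ hwa hb e])
      · have haX := memX.2 ⟨hap, ha'⟩
        rw [hc'u a' haX]
        exact fun e => φbeaten a' haX (mem_beatenColors.2 ⟨b, hb, .inr hbeat, e.symm⟩)
    · rw [f'D w hw] at hbeat
      rw [c'D a ha, c'D w hw]
      exact hc.avoid w hw a ha hwa b hb hbeat a' ha'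
  · rintro w (rfl | hw) z (rfl | hz) x y hx hy hxy
    · exact fun e => hxy.ne (proper_u x y hx hy e)
    · exact pendant_u z hz x y hx hy hxy
    · exact (pendant_u w hw y x hy hx hxy.symm).symm
    · rw [c'D w hw, c'D z hz]; exact hc.pendant w hw z hz x y hx hy hxy

open scoped Classical in
theorem exists_isTournamentColoring_singleton {Δ m : ℕ} (hΔ : ∀ v, T.degree v ≤ Δ)
    (hΔm : Δ ≤ 2 * m + 1) (h5 : 5 ≤ Δ) {L : Sym2 V → Finset ℕ} (hL : ∀ e, Δ + m ≤ (L e).card)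
    (r : V) : ∃ c f, IsTournamentColoring T C L m {r} c f := by
  obtain ⟨φ, hφ, hφL⟩ := exists_injOn_of_sum_le_two (X := T.neighborFinset r)
    (A := fun b => L s(r, b)) (r := fun _ => 0) (N := Δ) (by omega) (hΔ r)
    (fun b _ => by have := hL s(r, b); omega) (by simp)
  obtain ⟨c, hc, -⟩ := exists_recoloring (fun _ => 0) r (T.neighborFinset r) φ
  obtain ⟨f, finj, fle⟩ : ∃ f : V → ℕ, Set.InjOn f (T.neighborFinset r) ∧
      ∀ x ∈ T.neighborFinset r, f x ≤ 2 * m := by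
    rcases (T.neighborFinset r).eq_empty_or_nonempty with he | ⟨p, hp⟩
    · rw [he]; exact ⟨fun _ => 0, by simp, by simp⟩
    · obtain ⟨f, h1, h2, -⟩ := exists_position (m := m) (S := ∅) ((hΔ r).trans hΔm) hp (by simp)
        (by simp) (by simp)
      exact ⟨f, h1, h2⟩
  have hc : ∀ {b}, T.Adj r b → c s(r, b) = φ b := fun hb => hc _ (by simpa using hb)
  have proper : ∀ {a b}, T.Adj r a → T.Adj r b → c s(r, a) = c s(r, b) → a = b := by
    intro a b ha hb e
    rw [hc ha, hc hb] at e
    exact hφ (by simpa using ha) (by simpa using hb) e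
  refine ⟨c, fun _ => f, ?_, ?_, ?_, ?_, ?_, ?_⟩
  · rintro _ rfl a ha
    rw [hc ha]; exact hφL a (by simpa using ha)
  · rintro _ rfl a b ha hb e
    exact proper ha hb e
  · rintro _ rfl a b ha hb e
    exact finj (by simpa using ha) (by simpa using hb) e
  · rintro _ rfl a ha
    exact fle a (by simpa using ha)
  · rintro _ rfl _ rfl h
    exact absurd rfl h.ne
  · rintro _ rfl _ rfl x y hx hy hxy e
    exact hxy.ne (proper hx hy e)

open scoped Classical in
/-- The characteristic tree has a list coloring that satisfies the tournament conditions at all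
inner vertices. -/
theorem IsGeneralizedHalin.exists_isTournamentColoring (h : H.IsGeneralizedHalin T C) {Δ m : ℕ}
    (hΔ : ∀ v, T.degree v ≤ Δ) (hΔm : Δ ≤ 2 * m + 1) (h5 : 5 ≤ Δ) {L : Sym2 V → Finset ℕ}
    (hL : ∀ e, Δ + m ≤ (L e).card) :
    ∃ c f, IsTournamentColoring T C L m {v | T.degree v ≠ 1} c f := by
  have h3 := h.three_le_maxDegree
  have : Nonempty V := h.isTree.connected.nonempty
  obtain ⟨r, hr⟩ := T.exists_maximal_degree_vertex
  have hr1 : T.degree r ≠ 1 := by omega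
  -- Connected sets of inner vertices around r that carry a coloring; a largest one is shown to
  -- contain all inner vertices.
  let good : Finset V → Prop := fun D => (∀ w ∈ D, T.degree w ≠ 1) ∧
    (∀ w ∈ D, ∃ q : T.Walk r w, ∀ x ∈ q.support, x ∈ D) ∧ r ∈ D ∧
      ∃ c f, IsTournamentColoring T C L m D c f
  have hgood : good {r} := by
    refine ⟨by simpa using hr1, ?_, by simp, ?_⟩
    · intro w hw
      obtain rfl : w = r := by simpa using hw
      exact ⟨.nil, by simp⟩
    · simpa using exists_isTournamentColoring_singleton hΔ hΔm h5 hL r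
  obtain ⟨D, hDg, hmax⟩ := Finset.exists_max_image (Finset.univ.filter good) Finset.card
    ⟨{r}, by simpa using hgood⟩
  obtain ⟨hD1, hD2, hrD, c, f, hc⟩ := (Finset.mem_filter.1 hDg).2
  suffices hall : ∀ v, T.degree v ≠ 1 → v ∈ D by
    have : (D : Set V) = {v | T.degree v ≠ 1} := Set.ext fun v => ⟨hD1 v, hall v⟩
    exact ⟨c, f, this ▸ hc⟩
  intro v hv
  by_contra hvD
  obtain ⟨q⟩ := h.isTree.connected r v
  obtain ⟨nb, hnb⟩ := exists_leaf_neighbor T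
  -- The leaves attached to D are included, so that the walk can leave this set only from a vertex
  -- of D to an inner vertex, which then can be inserted.
  obtain ⟨d, -, hd1, hd2⟩ := q.exists_boundary_dart
    {x | x ∈ D ∨ T.degree x = 1 ∧ ∃ w ∈ D, T.Adj x w} (.inl hrD)
    (by rintro (h' | ⟨h', -⟩); exacts [hvD h', hv h'])
  have hd1D : d.fst ∈ D := by
    rcases hd1 with h' | ⟨h1, w, hw, hdw⟩
    · exact h'
    · refine absurd (.inl ?_) hd2
      rw [(hnb _ h1).2 _ d.adj, ← (hnb _ h1).2 _ hdw]
      exact hw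
  have hd2D : d.snd ∉ D := fun h' => hd2 (.inl h')
  have hd2l : T.degree d.snd ≠ 1 := fun h' => hd2 (.inr ⟨h', _, hd1D, d.adj.symm⟩)
  obtain ⟨c', f', hc'⟩ := hc.exists_insert h hΔ hΔm h5 hL hD1 hD2 hd2D hd2l hd1D d.adj.symm
  have hg : good (insert d.snd D) := by
    refine ⟨?_, ?_, Finset.mem_insert_of_mem hrD, c', f', by simpa using hc'⟩
    · intro w hw
      rcases Finset.mem_insert.1 hw with rfl | hw
      exacts [hd2l, hD1 w hw]
    · intro w hw
      rcases Finset.mem_insert.1 hw with rfl | hw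
      · obtain ⟨q, hq⟩ := hD2 _ hd1D
        refine ⟨q.concat d.adj, fun x hx => ?_⟩
        rw [Walk.support_concat] at hx
        simp only [List.mem_append, List.mem_singleton] at hx
        rcases hx with hx | rfl
        · exact Finset.mem_insert_of_mem (hq x hx)
        · exact Finset.mem_insert_self _ _
      · obtain ⟨q, hq⟩ := hD2 w hw
        exact ⟨q, fun x hx => Finset.mem_insert_of_mem (hq x hx)⟩
  have := hmax _ (by simpa using hg)
  rw [Finset.card_insert_of_notMem hd2D] at this
  omega

end TreeColoring

/-! ### Coloring the cycle, and the upper bound. -/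

section Main

variable {V : Type*} [Fintype V] {H T C : SimpleGraph V}

open scoped Classical in
/-- A tree has at least as many leaves as the degree of any vertex. -/
theorem IsTree.degree_le_card_leaves (hT : T.IsTree) {w : V} (hw : 2 ≤ T.degree w) :
    T.degree w ≤ (Finset.univ.filter fun v => T.degree v = 1).card := by
  have hpos : ∀ v, 1 ≤ T.degree v := by
    intro v
    have : Nontrivial V := by
      obtain ⟨a, ha⟩ := Finset.card_pos.1 (show 0 < (T.neighborFinset w).card by
        rw [card_neighborFinset_eq_degree]; omega)
      exact ⟨w, a, ((mem_neighborFinset _ _ _).1 ha).ne⟩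
    exact hT.connected.preconnected.degree_pos_of_nontrivial v
  have h1 := T.sum_degrees_eq_twice_card_edges
  have h2 := hT.card_edgeFinset
  -- Every vertex other than w contributes at least 2 on the right, a leaf thanks to the extra 1.
  -- The degree sum is 2|V| - 2, so the leaves number at least the degree of w.
  have h3 : ∑ _v : V, (2 : ℕ) + T.degree w ≤
      ∑ v, (T.degree v + (if T.degree v = 1 then 1 else 0)) + 2 := by
    rw [← Finset.add_sum_erase _ _ (Finset.mem_univ w), ← Finset.add_sum_erase _ (fun v =>
      T.degree v + (if T.degree v = 1 then 1 else 0)) (Finset.mem_univ w)]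
    have : ∑ v ∈ Finset.univ.erase w, (2 : ℕ) ≤
        ∑ v ∈ Finset.univ.erase w, (T.degree v + (if T.degree v = 1 then 1 else 0)) := by
      refine Finset.sum_le_sum fun v _ => ?_
      have := hpos v
      split_ifs <;> omega
    split_ifs <;> omega
  rw [Finset.sum_add_distrib, Finset.sum_const, Finset.card_univ, smul_eq_mul] at h3
  rw [Finset.card_filter]
  omega

open scoped Classical in
/-- A tournament coloring of the characteristic tree extends to the adjoint cycle. -/
theorem IsGeneralizedHalin.exists_isStarEdgeColoring (h : H.IsGeneralizedHalin T C) {Δ m : ℕ}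
    (hΔm : m + 7 ≤ Δ) {w₀ : V} (hw₀ : 8 ≤ T.degree w₀) {L : Sym2 V → Finset ℕ}
    (hL : ∀ e, Δ + m ≤ (L e).card) {c : Sym2 V → ℕ} {f : V → V → ℕ}
    (hc : IsTournamentColoring T C L m {v | T.degree v ≠ 1} c f) :
    ∃ c' : Sym2 V → ℕ, H.IsStarEdgeColoring (fun e : H.edgeSet => c' e) ∧
      ∀ e ∈ H.edgeSet, c' e ∈ L e := by
  obtain ⟨n, v, hn3, hv, hC, hleaf⟩ := h.leafCycle.exists_enumeration
  obtain ⟨nb, hnb⟩ := exists_leaf_neighbor T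
  have hdisj : ∀ {x y}, C.Adj x y → ¬ T.Adj x y := fun hxy =>
    h.leafCycle.disjoint h.isTree h.three_le_maxDegree hxy
  have vleaf : ∀ i, T.degree (v i) = 1 := fun i => (hleaf _).2 ⟨i, rfl⟩
  have nbadj : ∀ i, T.Adj (v i) (nb (v i)) := fun i => (hnb _ (vleaf i)).1
  have nbuniq : ∀ i w, T.Adj (v i) w → w = nb (v i) := fun i => (hnb _ (vleaf i)).2
  have nbleaf : ∀ i, T.degree (nb (v i)) ≠ 1 := fun i =>
    h.isTree.degree_ne_one_of_adj_of_degree_eq_one h.three_le_maxDegree (nbadj i) (vleaf i)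
  have hn : 8 ≤ n := by
    have h1 := h.isTree.degree_le_card_leaves (w := w₀) (by omega)
    have h2 : (Finset.univ.filter fun v => T.degree v = 1) ⊆ (Finset.range n).image v := by
      intro x hx
      obtain ⟨i, rfl⟩ := (hleaf x).1 (Finset.mem_filter.1 hx).2
      refine Finset.mem_image.2 ⟨i % n, Finset.mem_range.2 (Nat.mod_lt _ (by omega)), ?_⟩
      rw [hv, Nat.mod_mod]
    have h3 := (Finset.card_le_card h2).trans Finset.card_image_le
    rw [Finset.card_range] at h3
    omega
  have vshift : ∀ i j, v i = v j ↔ v (i + 1) = v (j + 1) := by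
    intro i j
    rw [hv, hv]
    exact ⟨fun e => Nat.ModEq.add_right 1 e, fun e => Nat.ModEq.add_right_cancel' 1 e⟩
  have vper : ∀ i, v (i + n) = v i := fun i => by rw [hv, Nat.add_mod_right]
  have cadj : ∀ i, C.Adj (v i) (v (i + 1)) := fun i => (hC _ _).2 ⟨i, rfl⟩
  have nbr : ∀ i a, C.Adj (v (i + 1)) a → a = v i ∨ a = v (i + 2) := by
    intro i a ha
    obtain ⟨j, hj⟩ := (hC _ _).1 ha
    rcases Sym2.eq_iff.1 hj with ⟨h1, h2⟩ | ⟨h1, h2⟩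
    · right; rw [h2, eq_comm]; exact (vshift _ _).1 h1
    · left; rw [h2, eq_comm]; exact (vshift _ _).2 h1
  have nbrH : ∀ i a, H.Adj (v (i + 1)) a → a = nb (v (i + 1)) ∨ a = v i ∨ a = v (i + 2) :=
    fun i a ha => (h.adj_or_adj ha).elim (fun h => .inl (nbuniq _ _ h)) fun h => .inr (nbr i a h)
  have leaf1 : ∀ {x}, T.degree x = 1 → ∃ i, x = v (i + 1) := by
    intro x hx
    obtain ⟨i, rfl⟩ := (hleaf x).1 hx
    exact ⟨i + (n - 1), by rw [show i + (n - 1) + 1 = i + n by omega, vper]⟩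
  have innerH : ∀ {x a}, T.degree x ≠ 1 → H.Adj x a → T.Adj x a := fun hx hxa =>
    (h.adj_or_adj hxa).resolve_right fun h' => hx (h.leafCycle.degree_eq_one_of_adj h')
  let B : ℕ → Finset ℕ := fun i => beatenColors T m c f (nb (v i)) (v i)
  let pc : ℕ → ℕ := fun i => c s(v i, nb (v i))
  have pcper : ∀ i, pc (i + n) = pc i := fun i => by simp only [pc, vper]
  have Bcard : ∀ i, (B i).card ≤ m + 1 := fun i => hc.card_beatenColors_le (nbleaf i) (nbadj i).symm
  have pcB : ∀ i, pc i ∈ B i := fun i =>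
    mem_beatenColors.2 ⟨v i, (nbadj i).symm, .inl rfl, by rw [Sym2.eq_swap]⟩
  -- Avoiding B i and B (i + 1) gives properness against the pendant edges and the tournament
  -- conditions at their inner ends. The colors pc (i - 1) and pc (i + 2), with i - 1 written as i +
  -- (n - 1), are avoided so that a pendant color is missing at both neighboring leaves.
  let M : ℕ → Finset ℕ := fun i =>
    ((L s(v i, v (i + 1)) \ B i) \ B (i + 1)) \ {pc (i + (n - 1)), pc (i + 2)}
  have Mper : ∀ i, M (i + n) = M i := by
    intro i
    have e1 : v (i + n + 1) = v (i + 1) := by rw [show i + n + 1 = i + 1 + n by omega, vper]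
    have e2 : v (i + n + 2) = v (i + 2) := by rw [show i + n + 2 = i + 2 + n by omega, vper]
    have e3 : v (i + n + (n - 1)) = v (i + (n - 1)) := by
      rw [show i + n + (n - 1) = i + (n - 1) + n by omega, vper]
    simp only [M, B, pc, e1, e2, e3, vper]
  -- There remain Δ + m - 2(m + 1) - 2 = Δ - m - 4 colors, and Δ ≥ m + 7.
  have Mcard : ∀ i, 3 ≤ (M i).card := by
    intro i
    have h1 := Finset.le_card_sdiff (B i) (L s(v i, v (i + 1)))
    have h2 := Finset.le_card_sdiff (B (i + 1)) (L s(v i, v (i + 1)) \ B i)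
    have h3 := Finset.le_card_sdiff {pc (i + (n - 1)), pc (i + 2)}
      ((L s(v i, v (i + 1)) \ B i) \ B (i + 1))
    have h4 := Bcard i
    have h5 := Bcard (i + 1)
    have h6 := hL s(v i, v (i + 1))
    have h7 : ({pc (i + (n - 1)), pc (i + 2)} : Finset ℕ).card ≤ 2 := Finset.card_le_two
    simp only [M]
    omega
  obtain ⟨g, gper, gM, g1, g2⟩ := exists_cyclic_list_coloring hn M Mper Mcard
  have gM' : ∀ i, (((g i ∈ L s(v i, v (i + 1)) ∧ g i ∉ B i) ∧ g i ∉ B (i + 1)) ∧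
      (g i ≠ pc (i + (n - 1)) ∧ g i ≠ pc (i + 2))) := by
    intro i
    simpa only [M, Finset.mem_sdiff, Finset.mem_insert, Finset.mem_singleton, not_or] using gM i
  have gL : ∀ i, g i ∈ L s(v i, v (i + 1)) := fun i => (gM' i).1.1.1
  have gB0 : ∀ i, g i ∉ B i := fun i => (gM' i).1.1.2
  have gB1 : ∀ i, g i ∉ B (i + 1) := fun i => (gM' i).1.2
  have gp0 : ∀ i, g i ≠ pc i := fun i e => gB0 i (e ▸ pcB i)
  have gp1 : ∀ i, g i ≠ pc (i + 1) := fun i e => gB1 i (e ▸ pcB (i + 1))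
  have gp2 : ∀ i, g i ≠ pc (i + 2) := fun i => (gM' i).2.2
  have gpm : ∀ i, g (i + 1) ≠ pc i := fun i => by
    have := (gM' (i + 1)).2.1
    rwa [show i + 1 + (n - 1) = i + n by omega, pcper] at this
  have gcongr : ∀ i j, v i = v j → g i = g j := by
    intro i j e
    rw [hv] at e
    rw [← Function.Periodic.map_mod_nat gper i, ← Function.Periodic.map_mod_nat gper j, e]
  have vne2 : ∀ i, v i ≠ v (i + 2) := by
    intro i e
    rw [hv] at e
    have : 0 ≡ 2 [MOD n] := Nat.ModEq.add_left_cancel' i e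
    rw [Nat.ModEq, Nat.mod_eq_of_lt (by omega), Nat.mod_eq_of_lt (by omega)] at this
    omega
  have edge_inj : ∀ i j, s(v i, v (i + 1)) = s(v j, v (j + 1)) → g i = g j := by
    intro i j e
    rcases Sym2.eq_iff.1 e with ⟨h1, -⟩ | ⟨h1, h2⟩
    · exact gcongr _ _ h1
    · exact absurd (h2.symm.trans ((vshift _ _).1 h1)) (vne2 j)
  let c' : Sym2 V → ℕ := fun e => if h : ∃ i, e = s(v i, v (i + 1)) then g h.choose else c e
  have c'C : ∀ i, c' s(v i, v (i + 1)) = g i := by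
    intro i
    have h : ∃ j, s(v i, v (i + 1)) = s(v j, v (j + 1)) := ⟨i, rfl⟩
    simp only [c']
    rw [dif_pos h]
    exact (edge_inj _ _ h.choose_spec).symm
  have c'C' : ∀ i, c' s(v (i + 1), v i) = g i := fun i => by rw [Sym2.eq_swap, c'C]
  have c'T : ∀ {x y}, T.Adj x y → c' s(x, y) = c s(x, y) := by
    intro x y hxy
    simp only [c']
    rw [dif_neg]
    exact fun h => hdisj ((hC _ _).2 h) hxy
  have c'nb : ∀ i, c' s(v i, nb (v i)) = pc i := fun i => c'T (nbadj i)
  have proper : ∀ u a b, H.Adj u a → H.Adj u b → a ≠ b → c' s(u, a) ≠ c' s(u, b) := by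
    intro u a b ha hb hab
    by_cases hu : T.degree u = 1
    · obtain ⟨i, rfl⟩ := leaf1 hu
      rcases nbrH i a ha with rfl | rfl | rfl <;> rcases nbrH i b hb with rfl | rfl | rfl <;>
        simp only [c'nb, c'C, c'C']
      · exact absurd rfl hab
      · exact (gp1 i).symm
      · exact (gp0 _).symm
      · exact gp1 i
      · exact absurd rfl hab
      · exact g1 i
      · exact gp0 _
      · exact (g1 i).symm
      · exact absurd rfl hab
    · rw [c'T (innerH hu ha), c'T (innerH hu hb)]
      exact fun e => hab (hc.proper u hu a b (innerH hu ha) (innerH hu hb) e)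
  have avoid : ∀ u a b a', T.degree u ≠ 1 → T.Adj u a → T.Adj u b → Beats m (f u a) (f u b) →
      H.Adj a a' → c' s(a, a') ≠ c' s(u, b) := by
    intro u a b a' hu ha hb hbeat ha'
    rw [c'T hb]
    by_cases hal : T.degree a = 1
    · obtain ⟨i, rfl⟩ := leaf1 hal
      obtain rfl := nbuniq _ _ ha.symm
      have hB : c s(nb (v (i + 1)), b) ∈ B (i + 1) := mem_beatenColors.2 ⟨b, hb, .inr hbeat, rfl⟩
      rcases nbrH i a' ha' with rfl | rfl | rfl
      · rw [c'nb]
        intro e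
        refine hbeat.ne (congrArg _ (hc.proper _ hu _ _ ha hb ?_))
        rw [← e, Sym2.eq_swap]
      · rw [c'C']
        exact fun e => gB1 i (e ▸ hB)
      · rw [c'C]
        exact fun e => gB0 (i + 1) (e ▸ hB)
    · have := innerH hal ha'
      rw [c'T this]
      exact hc.avoid u hu a hal ha b hb hbeat a' this
  -- This settles every path or 4-cycle whose middle vertex is the leaf v (i + 2) and which uses its
  -- pendant edge.
  have pendant : ∀ i b b', C.Adj (v (i + 2)) b → H.Adj b b' → c' s(b, b') ≠ pc (i + 2) := by
    intro i b b' hb hb'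
    have hpend : ∀ j k, C.Adj (v j) (v k) → pc j ≠ pc k := by
      intro j k hjk e
      refine hc.pendant _ (nbleaf j) _ (nbleaf k) _ _ (nbadj j).symm (nbadj k).symm hjk ?_
      rw [Sym2.eq_swap, Sym2.eq_swap (a := nb (v k))]
      exact e
    rcases nbr (i + 1) b hb with rfl | rfl
    · rcases nbrH i b' hb' with rfl | rfl | rfl
      · rw [c'nb]; exact hpend _ _ (cadj _)
      · rw [c'C']; exact gp2 i
      · rw [c'C]; exact gp1 (i + 1)
    · rcases nbrH (i + 2) b' hb' with rfl | rfl | rfl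
      · rw [c'nb]; exact hpend _ _ (cadj (i + 2)).symm
      · rw [c'C']; exact gp0 (i + 2)
      · rw [c'C]; exact gpm (i + 2)
  refine ⟨c', isStarEdgeColoring_of_proper c' proper ?_, ?_⟩
  · intro u a b a' b' ha hb hab ha' hb' e1 e2
    by_cases hu : T.degree u = 1
    · obtain ⟨i, rfl⟩ : ∃ i, u = v (i + 2) := by
        obtain ⟨i, rfl⟩ := leaf1 hu
        obtain ⟨j, hj⟩ := leaf1 (vleaf i)
        exact ⟨j, (vshift _ _).1 hj⟩
      -- Middle vertex a leaf, both middle edges on C. By the avoided pendant colors and properness,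
      -- the outer edges also lie on C, so four consecutive edges of C would be bichromatic.
      have cyc : ∀ a' b', H.Adj (v (i + 1)) a' → H.Adj (v (i + 3)) b' →
          c' s(v (i + 1), a') = g (i + 2) → c' s(v (i + 3), b') ≠ g (i + 1) := by
        intro a' b' ha' hb' e1 e2
        have h1 : g i = g (i + 2) := by
          rcases nbrH i a' ha' with rfl | rfl | rfl
          · rw [c'nb] at e1; exact absurd e1.symm (gpm (i + 1))
          · rwa [c'C'] at e1
          · rw [c'C] at e1; exact absurd e1 (g1 (i + 1))
        have h2 : g (i + 3) = g (i + 1) := by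
          rcases nbrH (i + 2) b' hb' with rfl | rfl | rfl
          · rw [c'nb] at e2; exact absurd e2.symm (gp2 (i + 1))
          · rw [c'C'] at e2; exact absurd e2.symm (g1 (i + 1))
          · rwa [c'C] at e2
        exact g2 i h1 h2.symm
      have cl : C.Adj (v (i + 2)) (v (i + 1)) := (cadj (i + 1)).symm
      have cr : C.Adj (v (i + 2)) (v (i + 3)) := cadj (i + 2)
      rcases nbrH (i + 1) a ha with rfl | rfl | rfl <;>
        rcases nbrH (i + 1) b hb with rfl | rfl | rfl
      · exact hab rfl
      · exact pendant i _ b' cl hb' (e2.trans (c'nb _))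
      · exact pendant i _ b' cr hb' (e2.trans (c'nb _))
      · exact pendant i _ a' cl ha' (e1.trans (c'nb _))
      · exact hab rfl
      · exact cyc a' b' ha' hb' (e1.trans (c'C _)) (e2.trans (c'C' _))
      · exact pendant i _ a' cr ha' (e1.trans (c'nb _))
      · exact cyc b' a' hb' ha' (e2.trans (c'C _)) (e1.trans (c'C' _))
      · exact hab rfl
    · have hTa := innerH hu ha
      have hTb := innerH hu hb
      rcases beats_or_beats m (fun e => hab (hc.inj u hu a b hTa hTb e)) with hbeat | hbeat
      · exact avoid u a b a' hu hTa hTb hbeat ha' e1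
      · exact avoid u b a b' hu hTb hTa hbeat hb' e2
  · intro e he
    induction e with
    | h x y =>
      rcases h.adj_or_adj he with hT | hC'
      · rw [c'T hT]
        by_cases hx : T.degree x = 1
        · rw [Sym2.eq_swap]
          exact hc.mem y (h.isTree.degree_ne_one_of_adj_of_degree_eq_one h.three_le_maxDegree hT hx)
            x hT.symm
        · exact hc.mem x hx y hT
      · obtain ⟨i, hi⟩ := (hC _ _).1 hC'
        rw [hi, c'C]
        exact gL i

open scoped Classical in
/-- The vertices of degree at least four have the same neighbors in a generalized Halin graph and
in its characteristic tree. -/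
theorem IsGeneralizedHalin.degree_eq (h : H.IsGeneralizedHalin T C) {x : V} (hx : 4 ≤ H.degree x) :
    T.degree x = H.degree x := by
  obtain ⟨n, v, hn3, hv, hC, hleaf⟩ := h.leafCycle.exists_enumeration
  obtain ⟨nb, hnb⟩ := exists_leaf_neighbor T
  have hinner : T.degree x ≠ 1 := by
    intro hx1
    obtain ⟨i, rfl⟩ := (hleaf x).1 hx1
    have hsub : H.neighborFinset (v i) ⊆ {nb (v i), v (i + 1), v (i + (n - 1))} := by
      intro a ha
      simp only [Finset.mem_insert, Finset.mem_singleton]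
      rcases h.adj_or_adj ((mem_neighborFinset _ _ _).1 ha) with hT | hC'
      · exact .inl ((hnb _ hx1).2 _ hT)
      · obtain ⟨j, hj⟩ := (hC _ _).1 hC'
        rcases Sym2.eq_iff.1 hj with ⟨h1, rfl⟩ | ⟨h1, rfl⟩
        · rw [hv] at h1
          exact .inr (.inl ((hv _ _).2 (Nat.ModEq.add_right 1 h1.symm)))
        · rw [hv] at h1
          refine .inr (.inr ((hv _ _).2 ?_))
          have : j + 1 + (n - 1) ≡ i + (n - 1) [MOD n] := Nat.ModEq.add_right _ h1.symm
          rw [Nat.ModEq, show j + 1 + (n - 1) = j + n by omega, Nat.add_mod_right] at this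
          exact this
    have := (Finset.card_le_card hsub).trans Finset.card_le_three
    rw [card_neighborFinset_eq_degree] at this
    omega
  rw [← card_neighborFinset_eq_degree, ← card_neighborFinset_eq_degree]
  congr 1
  ext a
  rw [mem_neighborFinset, mem_neighborFinset]
  refine ⟨fun h' => by rw [h.eq_sup]; exact .inl h', fun h' => (h.adj_or_adj h').resolve_right ?_⟩
  intro hC'
  exact hinner (h.leafCycle.degree_eq_one_of_adj hC')

theorem IsGeneralizedHalin.starEdgeChoosable [DecidableRel H.Adj] (h : H.IsGeneralizedHalin T C)
    (h13 : 13 ≤ H.maxDegree) : H.StarEdgeChoosable (3 * H.maxDegree / 2) := by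
  classical
  intro L hL
  set Δ := H.maxDegree with hΔ
  have : Nonempty V := h.isTree.connected.nonempty
  obtain ⟨w₀, hw₀⟩ := H.exists_maximal_degree_vertex
  have hdeg : T.degree w₀ = H.degree w₀ := by
    have h4 : 4 ≤ H.degree w₀ := by omega
    convert h.degree_eq (x := w₀) (by convert h4)
  have hTH : T ≤ H := by rw [h.eq_sup]; exact le_sup_left
  have hTdeg : ∀ v, T.degree v ≤ Δ := fun v =>
    (degree_le_of_le hTH).trans (H.degree_le_maxDegree v)
  -- The tree and cycle lemmas use lists on all pairs of vertices; the list at a pair that is not an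
  -- edge only needs to be long enough.
  let L' : Sym2 V → Finset ℕ := fun e =>
    if he : e ∈ H.edgeSet then L ⟨e, he⟩ else Finset.range (3 * Δ / 2)
  have hL' : ∀ e, Δ + Δ / 2 ≤ (L' e).card := by
    intro e
    simp only [L']
    split_ifs with he
    · have := hL ⟨e, he⟩; omega
    · rw [Finset.card_range]; omega
  -- With m = ⌊Δ/2⌋ the list size is Δ + m, the tournament has room for Δ ≤ 2m + 1 neighbors, and
  -- the requirement m + 7 ≤ Δ of the cycle amounts to Δ ≥ 13.
  obtain ⟨c, f, hc⟩ := h.exists_isTournamentColoring (Δ := Δ) (m := Δ / 2)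
    (fun v => by convert hTdeg v) (by omega) (by omega) hL'
  obtain ⟨c', hstar, hmem⟩ := h.exists_isStarEdgeColoring (by omega) (w₀ := w₀)
    (by
      have : 8 ≤ T.degree w₀ := by omega
      convert this) hL' hc
  refine ⟨fun e => c' e, hstar, fun e => ?_⟩
  have := hmem e e.2
  simpa only [L', dif_pos e.2] using this

end Main

/-! ### The lower bound for trees. -/

section LowerBound

variable {V : Type*} {T : SimpleGraph V}

/-- The distances from u along the sequence are 2, 1, 0, 1, 2, and a' = b' would have two parents.
-/
theorem IsTree.nodup_of_adj (hT : T.IsTree) {u a b a' b' : V} (ha : T.Adj u a) (hb : T.Adj u b)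
    (hab : a ≠ b) (ha' : T.Adj a a') (hb' : T.Adj b b') (ha'u : a' ≠ u) (hb'u : b' ≠ u) :
    [a', a, u, b, b'].Nodup := by
  have d0 : T.dist u u = 0 := dist_self
  have d1 : ∀ {x}, T.Adj u x → T.dist u x = 1 := fun h => dist_eq_one_iff_adj.2 h
  have d2 : ∀ {x y}, T.Adj u x → T.Adj x y → y ≠ u → T.dist u y = 2 := by
    intro x y hx hxy hy
    have h1 := d1 hx
    rcases hT.dist_eq_dist_add_one_of_adj u hxy with h | h
    · have : T.dist u y = 0 := by omega
      exact absurd (hT.connected.dist_eq_zero_iff.1 this).symm hy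
    · omega
  have ea := d1 ha
  have eb := d1 hb
  have ea' := d2 ha ha' ha'u
  have eb' := d2 hb hb' hb'u
  have hne : a' ≠ b' := by
    rintro rfl
    exact hab (hT.eq_of_adj_of_dist (r := u) ha'.symm hb'.symm (by omega) (by omega))
  simp only [List.nodup_cons, List.mem_cons, List.not_mem_nil, or_false, not_or, not_false_eq_true,
    List.nodup_nil, and_true]
  refine ⟨⟨ha'.ne', ha'u, ?_, hne⟩, ⟨ha.ne', hab, ?_⟩, ⟨hb.ne, hb'u.symm⟩, hb'.ne⟩
  · rintro rfl; omega
  · rintro rfl; omega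

open scoped Classical in
/-- If all neighbors of a vertex of degree `d` of a tree have degree at least `d`, then a star edge
coloring of the tree has at least `⌊3d/2⌋` colors. -/
theorem IsTree.le_of_starEdgeColorable [Fintype V] (hT : T.IsTree) {u : V} {d : ℕ} (hd : 0 < d)
    (hu : T.degree u = d) (hn : ∀ a, T.Adj u a → d ≤ T.degree a) {k : ℕ}
    (hk : T.StarEdgeColorable k) : 3 * d / 2 ≤ k := by
  obtain ⟨c₀, hc₀⟩ := hk
  let c : Sym2 V → ℕ := fun e => if h : e ∈ T.edgeSet then (c₀ ⟨e, h⟩ : ℕ) else 0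
  have cval : ∀ {x y} (h : T.Adj x y), c s(x, y) = (c₀ ⟨s(x, y), h⟩ : ℕ) := fun h => dif_pos h
  have clt : ∀ {x y}, T.Adj x y → c s(x, y) < k := fun h => by rw [cval h]; exact (c₀ _).2
  have proper : ∀ {w x y}, T.Adj w x → T.Adj w y → c s(w, x) = c s(w, y) → x = y := by
    intro w x y hx hy e
    by_contra hxy
    rw [cval hx, cval hy] at e
    exact hc₀.proper _ _ (fun h => hxy (Sym2.congr_right.1 (congrArg Subtype.val h)))
      ⟨w, by simp, by simp⟩ (Fin.ext e)
  set N := T.neighborFinset u with hN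
  have memN : ∀ {a}, a ∈ N ↔ T.Adj u a := by simp [hN]
  have cardN : N.card = d := hu
  -- The color of ub is seen at a. If also the color of ua were seen at b, there would be a
  -- bichromatic path with middle vertex u, so U is antisymmetric.
  let U : V → V → Prop := fun a b => ∃ a', T.Adj a a' ∧ c s(a, a') = c s(u, b)
  have anti : ∀ a b, T.Adj u a → T.Adj u b → a ≠ b → U a b → ¬ U b a := by
    rintro a b ha hb hab ⟨a', ha', e1⟩ ⟨b', hb', e2⟩
    have ha'u : a' ≠ u := by
      rintro rfl
      rw [Sym2.eq_swap] at e1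
      exact hab (proper ha hb e1)
    have hb'u : b' ≠ u := by
      rintro rfl
      rw [Sym2.eq_swap] at e2
      exact hab (proper hb ha e2).symm
    have h1 := hc₀.not_bichromatic ha'.symm ha.symm hb hb'
      (hT.nodup_of_adj ha hb hab ha' hb' ha'u hb'u)
    refine h1 (Fin.ext ?_) (Fin.ext ?_)
    · rw [← cval, ← cval, Sym2.eq_swap, e1]
    · rw [← cval, ← cval, Sym2.eq_swap, e2]
  set R := (N ×ˢ N).filter fun q => q.1 ≠ q.2 ∧ U q.1 q.2 with hR
  have cardR : 2 * R.card ≤ d * d - d := by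
    have hdisj : Disjoint R (R.image Prod.swap) := by
      rw [Finset.disjoint_left]
      rintro ⟨a, b⟩ h1 h2
      obtain ⟨⟨a', b'⟩, h3, h4⟩ := Finset.mem_image.1 h2
      simp only [Prod.swap_prod_mk, Prod.mk.injEq] at h4
      obtain ⟨rfl, rfl⟩ := h4
      simp only [hR, Finset.mem_filter, Finset.mem_product, memN] at h1 h3
      exact anti _ _ h1.1.1 h1.1.2 h1.2.1 h1.2.2 h3.2.2
    have hsub : R ∪ R.image Prod.swap ⊆ N.offDiag := by
      rintro ⟨a, b⟩ h
      rw [Finset.mem_offDiag]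
      rcases Finset.mem_union.1 h with h | h
      · simp only [hR, Finset.mem_filter, Finset.mem_product] at h
        exact ⟨h.1.1, h.1.2, h.2.1⟩
      · obtain ⟨⟨a', b'⟩, h3, h4⟩ := Finset.mem_image.1 h
        simp only [Prod.swap_prod_mk, Prod.mk.injEq] at h4
        obtain ⟨rfl, rfl⟩ := h4
        simp only [hR, Finset.mem_filter, Finset.mem_product] at h3
        exact ⟨h3.1.2, h3.1.1, h3.2.1.symm⟩
    have := Finset.card_le_card hsub
    rw [Finset.card_union_of_disjoint hdisj, Finset.card_image_of_injective _ Prod.swap_injective,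
      Finset.offDiag_card, cardN] at this
    omega
  let F : V → Finset V := fun a => N.filter fun b => a ≠ b ∧ U a b
  have sumF : ∑ a ∈ N, (F a).card = R.card := by
    rw [← Finset.card_sigma]
    refine Finset.card_bij (fun q _ => (q.1, q.2)) ?_ ?_ ?_
    · rintro ⟨a, b⟩ h
      simp only [Finset.mem_sigma, F, Finset.mem_filter] at h
      simp only [hR, Finset.mem_filter, Finset.mem_product]
      exact ⟨⟨h.1, h.2.1⟩, h.2.2⟩
    · rintro ⟨a, b⟩ - ⟨a', b'⟩ - h
      simpa using h
    · rintro ⟨a, b⟩ h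
      simp only [hR, Finset.mem_filter, Finset.mem_product] at h
      exact ⟨⟨a, b⟩, by simp only [Finset.mem_sigma, F, Finset.mem_filter]; exact
        ⟨h.1.1, h.1.2, h.2⟩, rfl⟩
  -- At most d(d - 1)/2 ordered pairs are related by U, so some neighbor sees at most (d - 1)/2 of
  -- the other colors at u.
  obtain ⟨a, ha, haF⟩ : ∃ a ∈ N, 2 * (F a).card < d := by
    by_contra! hcon
    have h1 : N.card • d ≤ ∑ a ∈ N, 2 * (F a).card := Finset.card_nsmul_le_sum _ _ _ hcon
    rw [← Finset.mul_sum, sumF, cardN, smul_eq_mul] at h1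
    have : 0 < d * d := Nat.mul_pos hd hd
    omega
  have hua := memN.1 ha
  set A := (T.neighborFinset a).image fun a' => c s(a, a') with hA
  set B := N.image fun b => c s(u, b) with hB
  have cardA : d ≤ A.card := by
    rw [hA, Finset.card_image_of_injOn]
    · exact hn a hua
    · intro x hx y hy e
      exact proper (by simpa using hx) (by simpa using hy) e
  have cardB : B.card = d := by
    rw [hB, Finset.card_image_of_injOn, cardN]
    intro x hx y hy e
    exact proper (memN.1 hx) (memN.1 hy) e
  have cardAB : (A ∩ B).card ≤ (F a).card + 1 := by
    have : A ∩ B ⊆ (insert a (F a)).image fun b => c s(u, b) := by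
      intro x hx
      obtain ⟨h1, h2⟩ := Finset.mem_inter.1 hx
      obtain ⟨a', ha', rfl⟩ := Finset.mem_image.1 h1
      obtain ⟨b, hb, e⟩ := Finset.mem_image.1 h2
      refine Finset.mem_image.2 ⟨b, ?_, e⟩
      by_cases hab : a = b
      · rw [hab]; exact Finset.mem_insert_self _ _
      · refine Finset.mem_insert_of_mem (Finset.mem_filter.2 ⟨hb, hab, a', ?_, e.symm⟩)
        simpa using ha'
    exact (Finset.card_le_card this).trans (Finset.card_image_le.trans (Finset.card_insert_le _ _))
  have cardU : (A ∪ B).card ≤ k := by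
    have : A ∪ B ⊆ Finset.range k := by
      intro x hx
      rw [Finset.mem_range]
      rcases Finset.mem_union.1 hx with h | h
      · obtain ⟨a', ha', rfl⟩ := Finset.mem_image.1 h
        exact clt (by simpa using ha')
      · obtain ⟨b, hb, rfl⟩ := Finset.mem_image.1 h
        exact clt (memN.1 hb)
    simpa using Finset.card_le_card this
  -- The count is k ≥ 2d - 1 - ⌊(d - 1)/2⌋ = ⌊3d/2⌋.
  have := Finset.card_union_add_card_inter A B
  omega

end LowerBound

/-! ### Plane embeddings from cyclic orders of neighbors and face labels. -/

section CyclicEnumeration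

variable {V : Type*}

/-- For each vertex `x`, the sequence `e x` runs periodically, with period `k x`, through the
neighbors of `x`. -/
structure IsCyclicEnumeration (G : SimpleGraph V) (k : V → ℕ) (e : V → ℕ → V) : Prop where
  pos : ∀ x, 0 < k x
  eq_iff : ∀ x i j, e x i = e x j ↔ i % k x = j % k x
  adj_iff : ∀ x y, G.Adj x y ↔ ∃ i, e x i = y

namespace IsCyclicEnumeration

variable {G : SimpleGraph V} {k : V → ℕ} {e : V → ℕ → V}

theorem degree_eq (h : G.IsCyclicEnumeration k e) (x : V) [Fintype (G.neighborSet x)] :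
    G.degree x = k x := by
  classical
  have : G.neighborFinset x = (Finset.range (k x)).image (e x) := by
    ext y
    rw [mem_neighborFinset, h.adj_iff]
    simp only [Finset.mem_image, Finset.mem_range]
    constructor
    · rintro ⟨i, rfl⟩
      exact ⟨i % k x, Nat.mod_lt _ (h.pos x), (h.eq_iff _ _ _).2 (Nat.mod_mod _ _)⟩
    · rintro ⟨i, -, rfl⟩
      exact ⟨i, rfl⟩
  rw [← card_neighborFinset_eq_degree, this, Finset.card_image_of_injOn, Finset.card_range]
  intro i hi j hj hij
  have := (h.eq_iff x i j).1 hij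
  rwa [Nat.mod_eq_of_lt (by simpa using hi), Nat.mod_eq_of_lt (by simpa using hj)] at this

theorem comap {W : Type*} (h : G.IsCyclicEnumeration k e) (ψ : W ≃ V) :
    (G.comap ψ).IsCyclicEnumeration (fun x => k (ψ x)) (fun x i => ψ.symm (e (ψ x) i)) where
  pos x := h.pos _
  eq_iff x i j := by rw [ψ.symm.injective.eq_iff, h.eq_iff]
  adj_iff x y := by
    rw [comap_adj, h.adj_iff]
    simp only [Equiv.symm_apply_eq]

/-- A cyclic enumeration of the neighbors of each vertex gives a rotation system. -/
theorem exists_rotationSystem [Finite V] (h : G.IsCyclicEnumeration k e) :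
    ∃ σ : G.RotationSystem, ∀ (d : G.Dart) (i : ℕ), d.snd = e d.fst i →
      (σ.next d).fst = d.fst ∧ (σ.next d).snd = e d.fst (i + 1) := by
  choose idx hidx using fun d : G.Dart => (h.adj_iff d.fst d.snd).1 d.adj
  let nx : G.Dart → G.Dart := fun d => ⟨(d.fst, e d.fst (idx d + 1)), (h.adj_iff _ _).2 ⟨_, rfl⟩⟩
  have hnx : ∀ (d : G.Dart) (i : ℕ), d.snd = e d.fst i → (nx d).snd = e d.fst (i + 1) := by
    intro d i hi
    refine (h.eq_iff _ _ _).2 (Nat.ModEq.add_right 1 ?_)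
    exact (h.eq_iff _ _ _).1 ((hidx d).trans hi)
  have inj : nx.Injective := by
    intro d d' hdd
    have h1 : (nx d).fst = (nx d').fst := by rw [hdd]
    have h2 : (nx d).snd = (nx d').snd := by rw [hdd]
    change d.fst = d'.fst at h1
    change e d.fst (idx d + 1) = e d'.fst (idx d' + 1) at h2
    rw [h1, h.eq_iff] at h2
    have h3 := (h.eq_iff d'.fst _ _).2 (Nat.ModEq.add_right_cancel' 1 h2)
    refine Dart.ext _ _ (Prod.ext h1 ?_)
    show d.snd = d'.snd
    rw [← hidx d, ← hidx d', h1, h3]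
  have : Finite G.Dart := Finite.of_injective (fun d : G.Dart => d.toProd)
    fun _ _ h => Dart.ext _ _ h
  let next : Equiv.Perm G.Dart := Equiv.ofBijective nx (Finite.injective_iff_bijective.1 inj)
  have pow : ∀ (j : ℕ) (d : G.Dart),
      ((next ^ j) d).fst = d.fst ∧ ((next ^ j) d).snd = e d.fst (idx d + j) := by
    intro j d
    induction j with
    | zero => exact ⟨rfl, (hidx d).symm⟩
    | succ j ih =>
      rw [pow_succ', Equiv.Perm.mul_apply]
      refine ⟨ih.1, ?_⟩
      have := hnx ((next ^ j) d) (idx d + j) (by rw [ih.2, ih.1])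
      rw [ih.1] at this
      exact this
  refine ⟨⟨next, fun d d' => ⟨fun hs => ?_, fun hs => ?_⟩⟩, fun d i hi => ⟨rfl, hnx d i hi⟩⟩
  · obtain ⟨j, -, rfl⟩ := hs.exists_pow_eq'
    exact (pow j d).1.symm
  · have hk := h.pos d.fst
    -- The exponent is idx d' - idx d modulo the period, made nonnegative by adding a multiple of
    -- the period that is at least idx d.
    refine ⟨((idx d' + (k d.fst * (idx d + 1) - idx d) : ℕ) : ℤ), ?_⟩
    rw [zpow_natCast]
    obtain ⟨h1, h2⟩ := pow (idx d' + (k d.fst * (idx d + 1) - idx d)) d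
    refine Dart.ext _ _ (Prod.ext (h1.trans hs) (h2.trans ?_))
    have : idx d ≤ k d.fst * (idx d + 1) := by nlinarith
    rw [show idx d + (idx d' + (k d.fst * (idx d + 1) - idx d)) =
      idx d' + k d.fst * (idx d + 1) by omega]
    refine ((h.eq_iff _ _ _).2 (Nat.add_mul_mod_self_left _ _ _)).trans ?_
    rw [hs]
    exact hidx d'

end IsCyclicEnumeration

variable [Fintype V] {T C : SimpleGraph V}

open scoped Classical in
theorem isLeafCycle_of_enumeration {n : ℕ} (hn : 3 ≤ n) {v : ℕ → V}
    (hv : ∀ i j, v i = v j ↔ i % n = j % n)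
    (hC : ∀ x y, C.Adj x y ↔ ∃ i, s(x, y) = s(v i, v (i + 1)))
    (hleaf : ∀ x, T.degree x = 1 ↔ ∃ i, v i = x) : IsLeafCycle T C := by
  obtain ⟨n, rfl⟩ : ∃ m, n = m + 3 := ⟨n - 3, by omega⟩
  have step : ∀ a b : Fin (n + 3), (a - b).val = 1 → C.Adj (v b) (v a) := by
    intro a b hab
    rw [hC]
    refine ⟨b, ?_⟩
    have : v a = v (b + 1) := by
      rw [hv]
      have hb := b.2
      have ha := a.2
      rw [Fin.sub_def] at hab
      simp only at hab
      rw [Nat.mod_eq_of_lt ha]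
      rcases Nat.lt_or_ge (n + 3 - b + a) (n + 3) with h | h
      · rw [Nat.mod_eq_of_lt h] at hab
        obtain h1 : (b : ℕ) + 1 = n + 3 := by omega
        rw [h1, Nat.mod_self]; omega
      · rw [Nat.mod_eq_sub_mod h, Nat.mod_eq_of_lt (by omega)] at hab
        rw [Nat.mod_eq_of_lt (by omega)]; omega
    rw [this]
  let φ : cycleGraph (n + 3) →g C :=
    { toFun := fun i => v i
      map_rel' := by
        intro a b hab
        rcases cycleGraph_adj'.1 hab with h | h
        · exact (step a b h).symm
        · exact step b a h }
  have hφ : Function.Injective φ := by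
    intro a b hab
    have := (hv a b).1 hab
    rw [Nat.mod_eq_of_lt a.2, Nat.mod_eq_of_lt b.2] at this
    exact Fin.ext this
  -- The standard cycle of `cycleGraph` runs through the indices downward.
  have getv : ∀ m, m ≤ n + 3 → ((cycleGraph.cycle n).map φ).getVert m = v (n + 3 - m) := by
    intro m hm
    rw [Walk.getVert_map, cycleGraph.getVert_cycle hm]
    exact (hv _ _).2 (Nat.mod_mod _ _)
  have hlen : ((cycleGraph.cycle n).map φ).length = n + 3 := by
    rw [Walk.length_map, cycleGraph.length_cycle]
  refine ⟨_, (cycleGraph.cycle n).map φ, cycleGraph.isCycle_cycle.map hφ, ?_, ?_⟩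
  · intro x
    rw [hleaf, Walk.mem_support_iff_exists_getVert]
    constructor
    · rintro ⟨m, rfl, hm⟩
      exact ⟨_, (getv m (hlen ▸ hm)).symm⟩
    · rintro ⟨i, rfl⟩
      have := Nat.mod_lt i (show 0 < n + 3 by omega)
      refine ⟨n + 3 - i % (n + 3), ?_, by omega⟩
      rw [getv _ (by omega), hv, show n + 3 - (n + 3 - i % (n + 3)) = i % (n + 3) by omega,
        Nat.mod_mod]
  · intro e he
    induction e with
    | h x y =>
      obtain ⟨i, hi⟩ := (hC x y).1 he
      rw [hi, ← Walk.adj_toSubgraph_iff_mem_edges, Walk.toSubgraph_adj_iff]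
      have := Nat.mod_lt i (show 0 < n + 3 by omega)
      refine ⟨n + 3 - (i % (n + 3) + 1), ?_, by omega⟩
      rw [getv _ (by omega), getv _ (by omega), Sym2.eq_swap]
      have h1 : v (n + 3 - (n + 3 - (i % (n + 3) + 1) + 1)) = v i := by
        rw [hv, show n + 3 - (n + 3 - (i % (n + 3) + 1) + 1) = i % (n + 3) by omega, Nat.mod_mod]
      have h2 : v (n + 3 - (n + 3 - (i % (n + 3) + 1))) = v (i + 1) := by
        rw [hv, show n + 3 - (n + 3 - (i % (n + 3) + 1)) = i % (n + 3) + 1 by omega,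
          Nat.mod_add_mod]
      rw [h1, h2]

open scoped Classical in
/-- A criterion for generalized Halin graphs: a labeling of the darts that is constant along the
facial walks, singles out the cycle through the leaves, and separates the edges of that cycle. -/
theorem isGeneralizedHalin_of_label (hT : T.IsTree) (h3 : 3 ≤ T.maxDegree) {n : ℕ} (hn : 3 ≤ n)
    {v : ℕ → V} (hv : ∀ i j, v i = v j ↔ i % n = j % n)
    (hC : ∀ x y, C.Adj x y ↔ ∃ i, s(x, y) = s(v i, v (i + 1)))
    (hleaf : ∀ x, T.degree x = 1 ↔ ∃ i, v i = x) {k : V → ℕ} {e : V → ℕ → V}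
    (he : (T ⊔ C).IsCyclicEnumeration k e) {ι : Type*} (lab : V → V → ι) (z : ι)
    (hlab : ∀ x i, lab (e x i) x = lab x (e x (i + 1)))
    (hz : ∀ x y, lab x y = z ↔ ∃ i, x = v i ∧ y = v (i + 1))
    (hsep : ∀ i j, lab (v (i + 1)) (v i) = lab (v (j + 1)) (v j) → v i = v j)
    (hz' : ∀ i, lab (v (i + 1)) (v i) ≠ z)
    (hstep : ∀ i, ∃ j, e (v (i + 1)) j = v i ∧ e (v (i + 1)) (j + 1) = v (i + 2)) :
    (T ⊔ C).IsGeneralizedHalin T C := by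
  have hlc : IsLeafCycle T C := isLeafCycle_of_enumeration hn hv hC hleaf
  obtain ⟨σ, hσ⟩ := he.exists_rotationSystem
  refine ⟨hT, h3, hlc, rfl, σ, ⟨hT.connected.mono le_sup_left, ?_⟩, ?_⟩
  all_goals
    have face : ∀ (d : (T ⊔ C).Dart) (i : ℕ), d.fst = e d.snd i →
        (σ.facePerm d).fst = d.snd ∧ (σ.facePerm d).snd = e d.snd (i + 1) :=
      fun d i hi => hσ d.symm i hi
    have labface : ∀ d : (T ⊔ C).Dart,
        lab (σ.facePerm d).fst (σ.facePerm d).snd = lab d.fst d.snd := by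
      intro d
      obtain ⟨i, hi⟩ := (he.adj_iff d.snd d.fst).1 d.adj.symm
      obtain ⟨h1, h2⟩ := face d i hi.symm
      rw [h1, h2, ← hlab, hi]
    have labsame : ∀ d d' : (T ⊔ C).Dart, σ.faceOf d = σ.faceOf d' →
        lab d.fst d.snd = lab d'.fst d'.snd := by
      have : Finite (T ⊔ C).Dart := Finite.of_injective (fun d : (T ⊔ C).Dart => d.toProd)
        fun _ _ h => Dart.ext _ _ h
      intro d d' hdd
      obtain ⟨i, -, rfl⟩ := (σ.faceOf_eq_iff.1 hdd).exists_pow_eq'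
      clear hdd
      induction i with
      | zero => rfl
      | succ i ih => rw [pow_succ', Equiv.Perm.mul_apply, labface, ← ih]
    have cadj : ∀ i, (T ⊔ C).Adj (v i) (v (i + 1)) := fun i => .inr ((hC _ _).2 ⟨i, rfl⟩)
    let out : ℕ → (T ⊔ C).Dart := fun i => ⟨(v i, v (i + 1)), cadj i⟩
    -- By `hstep` the facial walk continues along C at every leaf, so all these darts lie on one
    -- face.
    have outF : ∀ i, σ.faceOf (out i) = σ.faceOf (out 0) := by
      intro i
      induction i with
      | zero => rfl
      | succ i ih =>
        rw [← ih, ← σ.faceOf_facePerm (out i)]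
        obtain ⟨j, hj1, hj2⟩ := hstep i
        obtain ⟨h1, h2⟩ := face (out i) j hj1.symm
        congr 1
        exact Dart.ext _ _ (Prod.ext h1.symm (hj2.symm.trans h2.symm))
  · have vinj : Function.Injective fun i : Fin n => v i := by
      intro a b hab
      have := (hv a b).1 hab
      rw [Nat.mod_eq_of_lt a.2, Nat.mod_eq_of_lt b.2] at this
      exact Fin.ext this
    have vmod : ∀ i, v i = v (i % n) ∧ v (i + 1) = v (i % n + 1) := fun i =>
      ⟨(hv _ _).2 (Nat.mod_mod _ _).symm, (hv _ _).2 (Nat.mod_add_mod _ _ _).symm⟩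
    have cardC : Nat.card C.edgeSet = n := by
      rw [← Nat.card_fin n]
      refine (Nat.card_eq_of_bijective (fun i : Fin n =>
        (⟨s(v i, v (i + 1)), (hC _ _).2 ⟨i, rfl⟩⟩ : C.edgeSet)) ⟨?_, ?_⟩).symm
      · intro a b hab
        rcases Sym2.eq_iff.1 (congrArg Subtype.val hab) with ⟨h1, -⟩ | ⟨h1, h2⟩
        · exact vinj h1
        · exfalso
          have h3 : (a : ℕ) ≡ b + 1 [MOD n] := (hv _ _).1 h1
          have h4 : (a : ℕ) + 1 ≡ b [MOD n] := (hv _ _).1 h2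
          have h5 : (b : ℕ) + 2 ≡ b + 0 [MOD n] := (h3.add_right 1).symm.trans h4
          have h6 : 2 ≡ 0 [MOD n] := Nat.ModEq.add_left_cancel' _ h5
          rw [Nat.ModEq, Nat.mod_eq_of_lt (by omega), Nat.zero_mod] at h6
          omega
      · rintro ⟨e, he⟩
        induction e with
        | h x y =>
          obtain ⟨i, hi⟩ := (hC x y).1 he
          refine ⟨⟨i % n, Nat.mod_lt _ (by omega)⟩, Subtype.ext ?_⟩
          dsimp only
          rw [hi, ← (vmod i).1, ← (vmod i).2]
    have cardF : Nat.card σ.Face = n + 1 := by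
      have e1 : Nat.card (Option (Fin n)) = n + 1 := by simp
      rw [← e1]
      -- The labels show that these n + 1 faces are distinct. There are no others, because every
      -- face has a dart of C. Euler's formula follows by counting edges.
      let toFace : Option (Fin n) → σ.Face := fun o =>
        o.elim (σ.faceOf (out 0)) fun i => σ.faceOf (out i).symm
      have labout : lab (v 0) (v 1) = z := (hz _ _).2 ⟨0, rfl, rfl⟩
      refine (Nat.card_eq_of_bijective toFace ⟨?_, ?_⟩).symm
      · rintro (_ | a) (_ | b) hab
        · rfl
        · exact absurd ((labsame _ _ hab).symm.trans labout) (hz' b)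
        · exact absurd ((labsame _ _ hab).trans labout) (hz' a)
        · exact congrArg some (vinj (hsep a b (labsame _ _ hab)))
      · intro F
        obtain ⟨d, rfl, hd⟩ := hlc.exists_cycle_dart hT σ F
        obtain ⟨i, hi⟩ := (hC _ _).1 hd
        rcases Sym2.eq_iff.1 hi with ⟨h1, h2⟩ | ⟨h1, h2⟩
        · refine ⟨none, ?_⟩
          have : d = out i := Dart.ext _ _ (Prod.ext h1 h2)
          rw [this, outF]; rfl
        · refine ⟨some ⟨i % n, Nat.mod_lt _ (by omega)⟩, ?_⟩
          have : d = (out (i % n)).symm :=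
            Dart.ext _ _ (Prod.ext (h1.trans (vmod i).2) (h2.trans (vmod i).1))
          rw [this]; rfl
    have := card_edgeSet_sup_of_isLeafCycle hlc hT h3
    omega
  · refine ⟨σ.faceOf (out 0), Set.ext fun a => ⟨?_, ?_⟩⟩
    · rintro ⟨d, hd, rfl⟩
      obtain ⟨i, h1, h2⟩ := (hz _ _).1 ((labsame _ _ hd).trans ((hz _ _).2 ⟨0, rfl, rfl⟩))
      refine (hC _ _).2 ⟨i, ?_⟩
      rw [← h1, ← h2]
    · intro ha
      induction a with
      | h x y =>
        obtain ⟨i, hi⟩ := (hC x y).1 ha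
        exact ⟨out i, outF i, hi.symm⟩

end CyclicEnumeration

/-! ### The tree of radius two and its Halin graph. -/

namespace RadiusTwo

variable {d : ℕ}

/-- The vertices of the tree of radius two all of whose inner vertices have degree `d`: the center
`none`, its neighbors `(i, 0)`, and the leaves `(i, j)` with `j ≠ 0`. -/
abbrev Vertex (d : ℕ) : Type := Option (ZMod d × ZMod d)

/-- The successor of a leaf. -/
def leafSucc (x : ZMod d × ZMod d) : ZMod d × ZMod d :=
  if x.2 + 1 = 0 then (x.1 + 1, 1) else (x.1, x.2 + 1)

/-- The predecessor of a leaf. -/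
def leafPred (x : ZMod d × ZMod d) : ZMod d × ZMod d :=
  if x.2 = 1 then (x.1 - 1, -1) else (x.1, x.2 - 1)

/-- Adjacency in the tree. -/
def TreeAdj : Vertex d → Vertex d → Prop
  | none, none => False
  | none, some y => y.2 = 0
  | some x, none => x.2 = 0
  | some x, some y => x.1 = y.1 ∧ (x.2 = 0 ∧ y.2 ≠ 0 ∨ x.2 ≠ 0 ∧ y.2 = 0)

/-- Adjacency in the cycle through the leaves. -/
def CycleAdj : Vertex d → Vertex d → Prop
  | some x, some y => x.2 ≠ 0 ∧ y.2 ≠ 0 ∧ (y = leafSucc x ∨ x = leafSucc y)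
  | _, _ => False

/-- The neighbors in the tree, in cyclic order. -/
def treeEnum : Vertex d → ℕ → Vertex d
  | none, i => some (i, 0)
  | some x, i => if x.2 = 0 then if (i : ZMod d) = 0 then none else some (x.1, i) else some (x.1, 0)

/-- The degrees in the tree. -/
def treeDeg : Vertex d → ℕ
  | none => d
  | some x => if x.2 = 0 then d else 1

/-- The neighbors in the Halin graph, in cyclic order. -/
def halinEnum : Vertex d → ℕ → Vertex d
  | none, i => some (i, 0)
  | some x, i =>
    if x.2 = 0 then if (i : ZMod d) = 0 then none else some (x.1, i)
    else if i % 3 = 0 then some (x.1, 0) else if i % 3 = 1 then some (leafPred x)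
    else some (leafSucc x)

/-- The degrees in the Halin graph. -/
def halinDeg : Vertex d → ℕ
  | none => d
  | some x => if x.2 = 0 then d else 3

/-- The label of a dart: the face that contains it. The interior face of the edge from a leaf to its
successor is named after that leaf, and the exterior face is `none`. -/
def faceLabel : Vertex d → Vertex d → Option (ZMod d × ZMod d)
  -- Not a dart; any value other than `none` serves, since `none` has to single out the exterior
  -- darts among all pairs. The face between the branches i and i + 1 is named after the last leaf
  -- (i, -1) of branch i.
  | none, none => some (0, 0)
  | none, some y => some (y.1 - 1, -1)
  | some x, none => some (x.1, -1)
  | some x, some y =>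
    if x.2 = 0 then some (leafPred y) else if y.2 = 0 then some x
    else if y = leafSucc x then none else some y

/-- The enumeration of the leaves along the cycle. -/
def leaf (d k : ℕ) : ZMod d × ZMod d := ((k / (d - 1) : ℕ), (k % (d - 1) + 1 : ℕ))

theorem natCast_ne_zero {k : ℕ} (h0 : 0 < k) (hk : k < d) : (k : ZMod d) ≠ 0 := by
  rw [Ne, ZMod.natCast_eq_zero_iff]
  exact fun h => absurd (Nat.le_of_dvd h0 h) (by omega)

theorem one_ne_zero' (hd : 3 ≤ d) : (1 : ZMod d) ≠ 0 := by
  simpa using natCast_ne_zero (k := 1) (by omega) (by omega)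

theorem two_ne_zero' (hd : 3 ≤ d) : (1 + 1 : ZMod d) ≠ 0 := by
  have : ((2 : ℕ) : ZMod d) ≠ 0 := natCast_ne_zero (by omega) (by omega)
  rwa [show (1 + 1 : ZMod d) = ((2 : ℕ) : ZMod d) by norm_num]

theorem leafSucc_snd_ne_zero (hd : 3 ≤ d) (x : ZMod d × ZMod d) : (leafSucc x).2 ≠ 0 := by
  unfold leafSucc
  split_ifs with h
  · exact one_ne_zero' hd
  · exact h

theorem leafPred_snd_ne_zero (hd : 3 ≤ d) (x : ZMod d × ZMod d) : (leafPred x).2 ≠ 0 := by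
  unfold leafPred
  split_ifs with h
  · exact neg_ne_zero.2 (one_ne_zero' hd)
  · exact sub_ne_zero.2 h

theorem leafPred_leafSucc {x : ZMod d × ZMod d} (hx : x.2 ≠ 0) : leafPred (leafSucc x) = x := by
  obtain ⟨i, j⟩ := x
  unfold leafPred leafSucc
  dsimp only at hx ⊢
  by_cases h : j + 1 = 0
  · rw [if_pos h, if_pos rfl, add_sub_cancel_right, eq_neg_of_add_eq_zero_left h]
  · rw [if_neg h, if_neg (by simpa using hx), add_sub_cancel_right]

theorem leafSucc_leafPred {x : ZMod d × ZMod d} (hx : x.2 ≠ 0) : leafSucc (leafPred x) = x := by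
  obtain ⟨i, j⟩ := x
  unfold leafPred leafSucc
  dsimp only at hx ⊢
  by_cases h : j = 1
  · rw [if_pos h, if_pos (by simp), sub_add_cancel, h]
  · rw [if_neg h, if_neg (by simpa using hx), sub_add_cancel]

theorem leafSucc_leafSucc_ne (hd : 3 ≤ d) (x : ZMod d × ZMod d) : leafSucc (leafSucc x) ≠ x := by
  have h1 := one_ne_zero' hd
  have h2 := two_ne_zero' hd
  obtain ⟨i, j⟩ := x
  intro e
  unfold leafSucc at e
  dsimp only at e
  by_cases h : j + 1 = 0
  · rw [if_pos h, if_neg h2] at e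
    exact h1 (by simpa using congrArg Prod.fst e)
  · rw [if_neg h] at e
    dsimp only at e
    split_ifs at e with h'
    · exact h1 (by simpa using congrArg Prod.fst e)
    · exact h2 (by simpa [add_assoc] using congrArg Prod.snd e)

theorem leafSucc_ne (hd : 3 ≤ d) (x : ZMod d × ZMod d) : leafSucc x ≠ x := fun h =>
  leafSucc_leafSucc_ne hd x (by rw [h, h])

theorem leaf_snd_ne_zero (hd : 3 ≤ d) (k : ℕ) : (leaf d k).2 ≠ 0 := by
  have := Nat.mod_lt k (show 0 < d - 1 by omega)
  exact natCast_ne_zero (by omega) (by omega)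

theorem leafSucc_leaf (hd : 3 ≤ d) (k : ℕ) : leafSucc (leaf d k) = leaf d (k + 1) := by
  have hlt := Nat.mod_lt k (show 0 < d - 1 by omega)
  have hdiv := Nat.div_add_mod k (d - 1)
  have e : (leaf d k).2 + 1 = ((k % (d - 1) + 2 : ℕ) : ZMod d) := by
    simp only [leaf]; push_cast; ring
  unfold leafSucc
  rw [e]
  by_cases h : k % (d - 1) + 2 = d
  · rw [h, ZMod.natCast_self, if_pos rfl]
    have h1 : k + 1 = (d - 1) * (k / (d - 1) + 1) := by rw [mul_add, mul_one]; omega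
    unfold leaf
    rw [h1, Nat.mul_div_cancel_left _ (by omega), Nat.mul_mod_right]
    push_cast
    simp
  · rw [if_neg (natCast_ne_zero (by omega) (by omega))]
    have h1 : (k + 1) / (d - 1) = k / (d - 1) := by
      rw [Nat.div_eq_iff (by omega), mul_comm]
      constructor <;> omega
    have h2 : (k + 1) % (d - 1) = k % (d - 1) + 1 := by
      have := Nat.div_add_mod (k + 1) (d - 1)
      rw [h1] at this
      omega
    unfold leaf
    rw [h1, h2]

theorem leaf_eq_iff (hd : 3 ≤ d) (i j : ℕ) :
    leaf d i = leaf d j ↔ i % ((d - 1) * d) = j % ((d - 1) * d) := by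
  have hi := Nat.mod_lt i (show 0 < d - 1 by omega)
  have hj := Nat.mod_lt j (show 0 < d - 1 by omega)
  unfold leaf
  rw [Prod.mk.injEq, ZMod.natCast_eq_natCast_iff', ZMod.natCast_eq_natCast_iff', Nat.mod_mul,
    Nat.mod_mul, Nat.mod_eq_of_lt (a := i % (d - 1) + 1) (by omega),
    Nat.mod_eq_of_lt (a := j % (d - 1) + 1) (by omega)]
  constructor
  · rintro ⟨h1, h2⟩
    rw [h1, Nat.add_right_cancel h2]
  · intro h
    have h1 := congrArg (· % (d - 1)) h
    simp only [Nat.add_mul_mod_self_left, Nat.mod_mod] at h1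
    rw [h1] at h
    exact ⟨Nat.eq_of_mul_eq_mul_left (show 0 < d - 1 by omega) (Nat.add_left_cancel h), by rw [h1]⟩

theorem exists_leaf_eq (hd : 3 ≤ d) {x : ZMod d × ZMod d} (hx : x.2 ≠ 0) : ∃ k, leaf d k = x := by
  have : NeZero d := ⟨by omega⟩
  obtain ⟨i, j⟩ := x
  have hj := ZMod.val_lt j
  have hj0 : j.val ≠ 0 := fun h => hx ((ZMod.val_eq_zero j).1 h)
  refine ⟨(d - 1) * i.val + (j.val - 1), ?_⟩
  unfold leaf
  rw [Nat.mul_add_div (by omega), Nat.mul_add_mod, Nat.div_eq_of_lt (by omega),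
    Nat.mod_eq_of_lt (by omega), Nat.sub_add_cancel (by omega), add_zero, ZMod.natCast_zmod_val,
    ZMod.natCast_zmod_val]

/-- The tree of radius two all of whose inner vertices have degree `d`. -/
def tree (d : ℕ) : SimpleGraph (Vertex d) where
  Adj := TreeAdj
  symm := ⟨by
    rintro (_ | x) (_ | y) h <;> simp only [TreeAdj] at h ⊢
    · exact h
    · exact h
    · exact ⟨h.1.symm, h.2.symm.imp And.symm And.symm⟩⟩
  loopless := ⟨by
    rintro (_ | x) h <;> simp only [TreeAdj] at h
    tauto⟩

/-- The cycle through the leaves. -/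
def leafCycle (hd : 3 ≤ d) : SimpleGraph (Vertex d) where
  Adj := CycleAdj
  symm := ⟨by
    rintro (_ | x) (_ | y) h <;> simp only [CycleAdj] at h ⊢
    exact ⟨h.2.1, h.1, h.2.2.symm⟩⟩
  loopless := ⟨by
    rintro (_ | x) h <;> simp only [CycleAdj] at h
    exact leafSucc_ne hd x (by tauto)⟩

theorem leafCycle_adj_iff (hd : 3 ≤ d) (x y : Vertex d) : (leafCycle hd).Adj x y ↔
    ∃ i, s(x, y) = s(some (leaf d i), some (leaf d (i + 1))) := by
  constructor
  · intro h
    obtain _ | x := x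
    · exact h.elim
    obtain _ | y := y
    · exact h.elim
    obtain ⟨hx, hy, h⟩ := h
    rcases h with rfl | rfl
    · obtain ⟨i, rfl⟩ := exists_leaf_eq hd hx
      exact ⟨i, by rw [leafSucc_leaf hd]⟩
    · obtain ⟨i, rfl⟩ := exists_leaf_eq hd hy
      exact ⟨i, by rw [leafSucc_leaf hd, Sym2.eq_swap]⟩
  · rintro ⟨i, h⟩
    rw [← mem_edgeSet, h]
    exact ⟨leaf_snd_ne_zero hd i, leaf_snd_ne_zero hd _, .inl (leafSucc_leaf hd i).symm⟩

theorem natCast_eq_iff {i j : ℕ} : (i : ZMod d) = j ↔ i % d = j % d :=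
  ZMod.natCast_eq_natCast_iff' i j d

theorem exists_natCast_eq (hd : 3 ≤ d) (x : ZMod d) : ∃ i : ℕ, (i : ZMod d) = x := by
  have : NeZero d := ⟨by omega⟩
  exact ⟨x.val, ZMod.natCast_zmod_val x⟩

theorem hub_eq_iff (a : ZMod d) (i j : ℕ) :
    (if (i : ZMod d) = 0 then none else some (a, (i : ZMod d)) : Vertex d) =
      (if (j : ZMod d) = 0 then none else some (a, (j : ZMod d))) ↔ i % d = j % d := by
  rw [← natCast_eq_iff]
  split_ifs with h1 h2 h2
  · simp [h1, h2]
  · simp [h1, eq_comm, h2]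
  · simp [h1, h2]
  · simp

theorem hub_adj_iff (hd : 3 ≤ d) (a b : ZMod d) (hb : b = 0) (y : Vertex d) :
    (tree d).Adj (some (a, b)) y ↔
      ∃ i : ℕ, (if (i : ZMod d) = 0 then none else some (a, (i : ZMod d))) = y := by
  subst hb
  constructor
  · intro h
    obtain _ | ⟨a', b'⟩ := y
    · exact ⟨0, by simp⟩
    · obtain ⟨rfl, h⟩ : a = a' ∧ _ := h
      obtain ⟨i, rfl⟩ := exists_natCast_eq hd b'
      refine ⟨i, if_neg ?_⟩
      simpa using h
  · rintro ⟨i, rfl⟩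
    split_ifs with h
    · exact rfl
    · exact ⟨rfl, .inl ⟨rfl, h⟩⟩

theorem center_adj_iff (hd : 3 ≤ d) (y : Vertex d) :
    (tree d).Adj none y ↔ ∃ i : ℕ, some ((i : ZMod d), 0) = y := by
  constructor
  · intro h
    obtain _ | ⟨a, b⟩ := y
    · exact h.elim
    · obtain rfl : b = 0 := h
      obtain ⟨i, rfl⟩ := exists_natCast_eq hd a
      exact ⟨i, rfl⟩
  · rintro ⟨i, rfl⟩
    exact rfl

theorem leaf_adj_iff {a b : ZMod d} (hb : b ≠ 0) (y : Vertex d) :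
    (tree d).Adj (some (a, b)) y ↔ some (a, 0) = y := by
  constructor
  · intro h
    obtain _ | ⟨a', b'⟩ := y
    · exact absurd h hb
    · obtain ⟨rfl, h⟩ : a = a' ∧ _ := h
      rcases h with h | h
      · exact absurd h.1 hb
      · rw [show b' = 0 from h.2]
  · rintro rfl
    exact ⟨rfl, .inr ⟨hb, rfl⟩⟩

theorem center_eq_iff (i j : ℕ) :
    (some ((i : ZMod d), 0) : Vertex d) = some ((j : ZMod d), 0) ↔ i % d = j % d := by
  rw [← natCast_eq_iff]
  simp

theorem isCyclicEnumeration_tree (hd : 3 ≤ d) :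
    (tree d).IsCyclicEnumeration treeDeg treeEnum where
  pos x := by
    obtain _ | x := x <;> simp only [treeDeg]
    · omega
    · split_ifs <;> omega
  eq_iff x i j := by
    obtain _ | ⟨a, b⟩ := x <;> simp only [treeDeg, treeEnum]
    · exact center_eq_iff i j
    · by_cases hb : b = 0
      · simp only [hb, if_true]
        exact hub_eq_iff a i j
      · simp [hb, Nat.mod_one]
  adj_iff x y := by
    obtain _ | ⟨a, b⟩ := x <;> simp only [treeEnum]
    · exact center_adj_iff hd y
    · by_cases hb : b = 0
      · simp only [hb, if_true]
        exact hub_adj_iff hd a 0 rfl y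
      · simp only [hb, if_false, exists_const]
        exact leaf_adj_iff hb y

theorem isCyclicEnumeration_halin (hd : 3 ≤ d) :
    (tree d ⊔ leafCycle hd).IsCyclicEnumeration halinDeg halinEnum where
  pos x := by
    obtain _ | x := x <;> simp only [halinDeg]
    · omega
    · split_ifs <;> omega
  eq_iff x i j := by
    obtain _ | x := x <;> simp only [halinDeg, halinEnum]
    · exact center_eq_iff i j
    · by_cases hx : x.2 = 0
      · simp only [hx, if_true]
        exact hub_eq_iff x.1 i j
      · simp only [hx, if_false]
        have h1 : (x.1, (0 : ZMod d)) ≠ leafPred x := fun e =>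
          leafPred_snd_ne_zero hd x (by rw [← e])
        have h2 : (x.1, (0 : ZMod d)) ≠ leafSucc x := fun e =>
          leafSucc_snd_ne_zero hd x (by rw [← e])
        have h3 : leafPred x ≠ leafSucc x := fun e => leafSucc_leafSucc_ne hd x (by
          rw [← e, leafSucc_leafPred hx])
        have hi := Nat.mod_lt i (show 0 < 3 by omega)
        have hj := Nat.mod_lt j (show 0 < 3 by omega)
        generalize i % 3 = r at *
        generalize j % 3 = t at *
        interval_cases r <;> interval_cases t <;>
          simp [h1, h2, h3, h1.symm, h2.symm, h3.symm]
  adj_iff x y := by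
    rw [sup_adj]
    have hcyc : ∀ {x : ZMod d × ZMod d} {y : Vertex d}, x.2 ≠ 0 → ((leafCycle hd).Adj (some x) y ↔
        some (leafPred x) = y ∨ some (leafSucc x) = y) := by
      intro x y hx
      constructor
      · intro h
        obtain _ | y := y
        · exact h.elim
        · obtain ⟨-, hy, h⟩ := h
          rcases h with rfl | rfl
          · exact .inr rfl
          · exact .inl (by rw [leafPred_leafSucc hy])
      · rintro (rfl | rfl)
        · exact ⟨hx, leafPred_snd_ne_zero hd x, .inr (leafSucc_leafPred hx).symm⟩
        · exact ⟨hx, leafSucc_snd_ne_zero hd x, .inl rfl⟩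
    obtain _ | ⟨a, b⟩ := x
    · have : ¬ (leafCycle hd).Adj none y := id
      simp only [this, or_false, halinEnum]
      exact center_adj_iff hd y
    · by_cases hb : b = 0
      · subst hb
        have : ¬ (leafCycle hd).Adj (some (a, 0)) y := by
          obtain _ | y := y
          · exact id
          · exact fun h => h.1 rfl
        simp only [this, or_false, halinEnum, if_true]
        exact hub_adj_iff hd a 0 rfl y
      · rw [leaf_adj_iff hb, hcyc hb]
        simp only [halinEnum, hb, if_false]
        constructor
        · rintro (h | h | h)
          · exact ⟨0, by simpa using h⟩
          · exact ⟨1, by simpa using h⟩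
          · exact ⟨2, by simpa using h⟩
        · rintro ⟨i, rfl⟩
          split_ifs <;> simp

/-- The dart that arrives at x from one neighbor and the dart that leaves to the next one are
consecutive on a facial walk, so this is the constancy of the label on faces, checked at the center,
at its neighbors and at the leaves. -/
theorem faceLabel_halinEnum (hd : 3 ≤ d) (x : Vertex d) (i : ℕ) :
    faceLabel (halinEnum x i) x = faceLabel x (halinEnum x (i + 1)) := by
  obtain _ | x := x
  · simp [halinEnum, faceLabel]
  by_cases hx : x.2 = 0
  · simp only [halinEnum, hx, if_true]
    push_cast
    by_cases h : (i : ZMod d) = 0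
    · rw [if_pos h, h, zero_add, if_neg (one_ne_zero' hd)]
      simp [faceLabel, hx, leafPred]
    · rw [if_neg h]
      by_cases h' : (i + 1 : ZMod d) = 0
      · rw [if_pos h', eq_neg_of_add_eq_zero_left h']
        simp [faceLabel, hx, one_ne_zero' hd]
      · rw [if_neg h']
        simp [faceLabel, hx, h, leafPred]
  · have hs := leafSucc_snd_ne_zero hd x
    have hp := leafPred_snd_ne_zero hd x
    have hps : leafPred x ≠ leafSucc x := fun e => leafSucc_leafSucc_ne hd x (by
      rw [← e, leafSucc_leafPred hx])
    simp only [halinEnum, hx, if_false]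
    have hi := Nat.mod_lt i (show 0 < 3 by omega)
    rw [Nat.add_mod i 1 3]
    generalize i % 3 = r at *
    interval_cases r
    · simp [faceLabel, hx, hp, hps]
    · simp [faceLabel, hx, hp, hs, leafSucc_leafPred hx]
    · simp [faceLabel, hx, hs, (leafSucc_leafSucc_ne hd x).symm]

theorem faceLabel_eq_none_iff (hd : 3 ≤ d) (x y : Vertex d) :
    faceLabel x y = none ↔ ∃ i, x = some (leaf d i) ∧ y = some (leaf d (i + 1)) := by
  constructor
  · intro h
    obtain _ | x := x <;> obtain _ | y := y <;> simp only [faceLabel] at h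
    · simp at h
    · simp at h
    · simp at h
    · split_ifs at h with h1 h2 h3
      obtain ⟨i, rfl⟩ := exists_leaf_eq hd h1
      exact ⟨i, rfl, by rw [h3, leafSucc_leaf hd]⟩
  · rintro ⟨i, rfl, rfl⟩
    simp [faceLabel, leaf_snd_ne_zero hd, leafSucc_leaf hd]

theorem faceLabel_leaf (hd : 3 ≤ d) (i : ℕ) :
    faceLabel (some (leaf d (i + 1))) (some (leaf d i)) = some (leaf d i) := by
  have : leaf d i ≠ leafSucc (leaf d (i + 1)) := by
    rw [← leafSucc_leaf hd]
    exact (leafSucc_leafSucc_ne hd _).symm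
  simp [faceLabel, leaf_snd_ne_zero hd, this]

theorem isTree_tree (hd : 3 ≤ d) : (tree d).IsTree := by
  have : NeZero d := ⟨by omega⟩
  have hconn : (tree d).Connected := by
    have hub : ∀ a : ZMod d, (tree d).Reachable none (some (a, 0)) := fun a =>
      Adj.reachable (show (tree d).Adj none (some (a, 0)) from (rfl : (0 : ZMod d) = 0))
    have h0 : ∀ x, (tree d).Reachable none x := by
      rintro (_ | ⟨a, b⟩)
      · exact Reachable.refl _
      · by_cases hb : b = 0
        · rw [hb]; exact hub a
        · exact (hub a).trans (Adj.reachable ((leaf_adj_iff hb _).2 rfl)).symm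
    exact ⟨fun x y => (h0 x).symm.trans (h0 y)⟩
  refine isTree_iff_connected_and_card.2 ⟨hconn, le_antisymm ?_ ?_⟩
  · let parent : ZMod d × ZMod d → Vertex d := fun x => if x.2 = 0 then none else some (x.1, 0)
    have hsub : (tree d).edgeSet ⊆ Set.range fun x => s(some x, parent x) := by
      have aux : ∀ x y : Vertex d, (tree d).Adj x y →
          (∃ z, x = some z ∧ y = parent z) ∨ ∃ z, y = some z ∧ x = parent z := by
        rintro (_ | x) (_ | y) h
        · exact h.elim
        · exact .inr ⟨y, rfl, (if_pos h).symm⟩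
        · exact .inl ⟨x, rfl, (if_pos h).symm⟩
        · obtain ⟨h1, h2 | h2⟩ := h
          · exact .inr ⟨y, rfl, (congrArg some (show x = (y.1, 0) from Prod.ext h1 h2.1)).trans
              (if_neg h2.2).symm⟩
          · exact .inl ⟨x, rfl, (congrArg some (show y = (x.1, 0) from Prod.ext h1.symm h2.2)).trans
              (if_neg h2.1).symm⟩
      intro e he
      induction e with
      | h x y =>
        rcases aux x y he with ⟨z, rfl, rfl⟩ | ⟨z, rfl, rfl⟩
        · exact ⟨z, rfl⟩
        · exact ⟨z, Sym2.eq_swap⟩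
    have h1 := Set.ncard_le_ncard hsub (Set.toFinite _)
    have h2 : (Set.range fun x : ZMod d × ZMod d => s(some x, parent x)).ncard ≤
        Nat.card (ZMod d × ZMod d) := by
      rw [← Set.image_univ, ← Set.ncard_univ]
      exact Set.ncard_image_le (Set.toFinite _)
    rw [Nat.card_coe_set_eq, Finite.card_option]
    omega
  · exact hconn.card_vert_le_card_edgeSet_add_one

end RadiusTwo

open RadiusTwo

open scoped Classical in
/-- For each `d ≥ 3` there is a Halin graph of maximum degree `d` whose characteristic tree has
radius two and all inner vertices of degree `d`. -/
theorem exists_isHalin_radiusTwo {d : ℕ} (hd : 3 ≤ d) :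
    ∃ (n : ℕ) (H T C : SimpleGraph (Fin n)), H.IsHalin T C ∧ H.maxDegree = d ∧
      ∃ u, T.degree u = d ∧ ∀ a, T.Adj u a → T.degree a = d := by
  have : NeZero d := ⟨by omega⟩
  -- The graphs are transported to vertex sets `Fin n`, which gives an example in a fixed universe.
  let ψ : Fin (Fintype.card (Vertex d)) ≃ Vertex d := (Fintype.equivFin _).symm
  have hT := (isCyclicEnumeration_tree hd).comap ψ
  have hH := (isCyclicEnumeration_halin hd).comap ψ
  have hsup : (tree d ⊔ leafCycle hd).comap ψ = (tree d).comap ψ ⊔ (leafCycle hd).comap ψ := rfl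
  rw [hsup] at hH
  have hcenter : ((tree d).comap ψ).degree (ψ.symm none) = d := by
    rw [hT.degree_eq, Equiv.apply_symm_apply]; rfl
  have hhalin : ((tree d).comap ψ ⊔ (leafCycle hd).comap ψ).IsGeneralizedHalin
      ((tree d).comap ψ) ((leafCycle hd).comap ψ) := by
    refine isGeneralizedHalin_of_label ((Iso.comap ψ (tree d)).isTree_iff.2 (isTree_tree hd)) ?_
      (n := (d - 1) * d) ?_ (v := fun i => ψ.symm (some (leaf d i))) ?_ ?_ ?_ hH
      (fun x y => faceLabel (ψ x) (ψ y)) none ?_ ?_ ?_ ?_ ?_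
    · calc 3 ≤ d := hd
        _ = _ := hcenter.symm
        _ ≤ _ := degree_le_maxDegree _ _
    · have : 2 * 3 ≤ (d - 1) * d := Nat.mul_le_mul (by omega) hd
      omega
    · intro i j
      rw [ψ.symm.injective.eq_iff, Option.some_inj, leaf_eq_iff hd]
    · intro x y
      rw [comap_adj, leafCycle_adj_iff]
      refine exists_congr fun i => ?_
      rw [← (Sym2.map.injective ψ.injective).eq_iff]
      simp
    · intro x
      rw [hT.degree_eq]
      simp only [Equiv.symm_apply_eq]
      obtain _ | x := ψ x <;> simp only [treeDeg]
      · simp; omega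
      · split_ifs with h
        · refine ⟨fun h' => by omega, ?_⟩
          rintro ⟨i, hi⟩
          exact absurd h (by rw [← Option.some_inj.1 hi]; exact leaf_snd_ne_zero hd i)
        · obtain ⟨i, hi⟩ := exists_leaf_eq hd h
          exact ⟨fun _ => ⟨i, by rw [hi]⟩, fun _ => rfl⟩
    · intro x i
      simp only [Equiv.apply_symm_apply]
      exact faceLabel_halinEnum hd _ i
    · intro x y
      rw [faceLabel_eq_none_iff hd]
      simp only [Equiv.eq_symm_apply]
    · intro i j h
      simp only [Equiv.apply_symm_apply, faceLabel_leaf hd] at h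
      rw [h]
    · intro i
      simp only [Equiv.apply_symm_apply, faceLabel_leaf hd]
      simp
    · intro i
      have hs := leaf_snd_ne_zero hd (i + 1)
      refine ⟨1, ?_, ?_⟩
      · simp [halinEnum, ← leafSucc_leaf hd i, leafPred_leafSucc (leaf_snd_ne_zero hd i),
          leafSucc_snd_ne_zero hd]
      · simp [halinEnum, hs, leafSucc_leaf hd]
  generalize (tree d).comap ψ ⊔ (leafCycle hd).comap ψ = H at hH hhalin
  refine ⟨_, H, _, _, ⟨hhalin, ?_⟩, ?_, ψ.symm none, hcenter, ?_⟩
  · intro x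
    rw [hT.degree_eq]
    obtain _ | x := ψ x <;> simp only [treeDeg]
    · omega
    · split_ifs <;> omega
  · refine le_antisymm (maxDegree_le_of_forall_degree_le _ _ fun x => ?_) ?_
    · rw [hH.degree_eq]
      obtain _ | x := ψ x <;> simp only [halinDeg]
      · exact le_rfl
      · split_ifs <;> omega
    · refine le_trans (le_of_eq ?_) (degree_le_maxDegree _ (ψ.symm none))
      rw [hH.degree_eq, Equiv.apply_symm_apply]
      rfl
  · intro a ha
    rw [comap_adj, Equiv.apply_symm_apply, center_adj_iff hd] at ha
    obtain ⟨i, hi⟩ := ha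
    rw [hT.degree_eq, ← hi]
    simp [treeDeg]

/-! ### The two chromatic indices. -/

section Indices

variable {V : Type*} [Fintype V] {H T C : SimpleGraph V} [DecidableRel H.Adj]

theorem IsGeneralizedHalin.listStarChromaticIndex_le (h : H.IsGeneralizedHalin T C)
    (h13 : 13 ≤ H.maxDegree) :
    H.listStarChromaticIndex ≤ ((3 * H.maxDegree / 2 : ℕ) : ℕ∞) :=
  (h.starEdgeChoosable h13).listStarChromaticIndex_le

/-- The indices lie in a chain: that of T, that of its supergraph H, the list version for H, and the
upper bound. A lower bound for T that meets the upper bound collapses the chain. -/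
theorem IsGeneralizedHalin.index_eq (h : H.IsGeneralizedHalin T C) (h13 : 13 ≤ H.maxDegree)
    (hT : ((3 * H.maxDegree / 2 : ℕ) : ℕ∞) ≤ T.starChromaticIndex) :
    H.starChromaticIndex = ((3 * H.maxDegree / 2 : ℕ) : ℕ∞) ∧
      H.listStarChromaticIndex = ((3 * H.maxDegree / 2 : ℕ) : ℕ∞) := by
  have hTH : T ≤ H := by rw [h.eq_sup]; exact le_sup_left
  have h1 := hT.trans (starChromaticIndex_mono hTH)
  have h2 := starChromaticIndex_le_listStarChromaticIndex (G := H)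
  have h3 := h.listStarChromaticIndex_le h13
  exact ⟨le_antisymm (h2.trans h3) h1, le_antisymm h3 (h1.trans h2)⟩

end Indices

end SimpleGraph

theorem theorem1p5 :
    -- the upper bound
    (∀ (V : Type*) [Fintype V] (H T C : SimpleGraph V) [DecidableRel H.Adj],
      H.IsGeneralizedHalin T C → 13 ≤ H.maxDegree →
        H.listStarChromaticIndex ≤ ((3 * H.maxDegree / 2 : ℕ) : ℕ∞)) ∧
    -- the bound is attained whenever the characteristic tree attains it
    (∀ (V : Type*) [Fintype V] (H T C : SimpleGraph V) [DecidableRel H.Adj],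
      H.IsGeneralizedHalin T C → 13 ≤ H.maxDegree →
        T.starChromaticIndex = ((3 * H.maxDegree / 2 : ℕ) : ℕ∞) →
          H.starChromaticIndex = ((3 * H.maxDegree / 2 : ℕ) : ℕ∞) ∧
          H.listStarChromaticIndex = ((3 * H.maxDegree / 2 : ℕ) : ℕ∞)) ∧
    -- and this happens for Halin graphs of every maximum degree
    (∀ Δ : ℕ, 13 ≤ Δ →
      ∃ (n : ℕ) (H T C : SimpleGraph (Fin n)) (_ : DecidableRel H.Adj),
        H.IsHalin T C ∧ H.maxDegree = Δ ∧
        T.starChromaticIndex = ((3 * Δ / 2 : ℕ) : ℕ∞) ∧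
        H.starChromaticIndex = ((3 * Δ / 2 : ℕ) : ℕ∞) ∧
        H.listStarChromaticIndex = ((3 * Δ / 2 : ℕ) : ℕ∞)) := by
  classical
  refine ⟨fun V _ H T C _ h h13 => h.listStarChromaticIndex_le h13,
    fun V _ H T C _ h h13 hT => h.index_eq h13 hT.ge, fun Δ h13 => ?_⟩
  obtain ⟨n, H, T, C, h, hmax, u, hu, hnb⟩ :=
    SimpleGraph.exists_isHalin_radiusTwo (d := Δ) (by omega)
  -- The center of the tree of radius two and all its neighbors have degree Δ, so the lower bound
  -- for trees applies there. The reverse inequality for T comes from T ≤ H.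
  have hlow : ((3 * Δ / 2 : ℕ) : ℕ∞) ≤ T.starChromaticIndex := le_iInf₂ fun k hk =>
    Nat.cast_le.2 (h.isTree.le_of_starEdgeColorable (by omega) hu (fun a ha => (hnb a ha).ge) hk)
  have hTH : T ≤ H := by rw [h.eq_sup]; exact le_sup_left
  obtain rfl := hmax
  obtain ⟨h1, h2⟩ := h.index_eq h13 hlow
  exact ⟨n, H, T, C, inferInstance, h, rfl,
    le_antisymm ((SimpleGraph.starChromaticIndex_mono hTH).trans h1.le) hlow, h1, h2⟩
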